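/- **Setting.** Let $G$ be a connected, real linear, semisimple Lie group of non-compact type (a closed connected subgroup of some $\mathrm{GL}(d,\mathbb R)$ whose Lie algebra $\mathfrak g$ is semisimple without nonzero compact ideals). Fix a maximal compact subgroup $K$ with Lie algebra $\mathfrak k$, a Cartan decomposition $\mathfrak g=\mathfrak k\oplus\mathfrak p$, a maximal abelian subspace $\mathfrak a\subset\mathfrak p$, and a Weyl chamber of $\mathfrak a$ (a connected component of the complement of the kernels of the restricted roots) with closure $\mathfrak a^+$. Let $\mathfrak n$ be the sum of the root spaces of the roots that are positive on the chamber, $A=\exp\mathfrak a$, $N=\exp\mathfrak n$, and let $M$ be the centralizer of $A$ in $K$. Let $k_\iota\in K$ normalize $\mathfrak a$ with $\mathrm{Ad}(k_\iota)\mathfrak a^+=-\mathfrak a^+$. Put $\mathcal F=G/MAN$, $\eta_0=MAN\in\mathcal F$, $\check\eta_0=k_\iota\eta_0$ and $\mathcal F^{(2)}=\{(g\eta_0,g\check\eta_0): g\in G\}$. The Iwasawa cocycle $\sigma(g,\xi)$, for $g\in G$ and $\xi\in\mathcal F$, is the unique element of $\mathfrak a$ such that $gk\in K\exp(\sigma(g,\xi))N$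 for all $k\in K$ with $k\eta_0=\xi$. The Hopf coordinates are the map $G/M\to\mathcal F^{(2)}\times\mathfrak a$, $hM\mapsto(h\eta_0,h\check\eta_0;\sigma(h,\eta_0))$. For $x\in AM$ write $x=x_Ax_M$ with $x_A\in A$, $x_M\in M$. For $\theta\in\mathfrak a$ and $t\in\mathbb R$, let $\tilde\phi_\theta^t$ be right multiplication by $e^{t\theta}$, on $G$ and on $G/M$. A differentiable cross-section $s$ of $G\to\mathcal F$ is a differentiable map $s:\mathcal F_s\to G$ on an open set $\mathcal F_s\subset\mathcal F$ with $s(\xi)\eta_0=\xi$; it is compact valued if $s(\mathcal F_s)\subset K$. Put $\mathcal F_s^{(2)}=\{(\xi,\check\xi)\in\mathcal F^{(2)}:\xi\in\mathcal F_s\}$, and $$\mathcal H_s:s(\mathcal F_s)NAM\to\mathcal F_s^{(2)}\times AM,\qquad g=s(\xi)ux\mapsto(g\eta_0,g\check\eta_0;x)_s\quad(\xi\in\mathcal F_s,\ u\in N,\ x\in AM).$$ For cross-sections $s,s'$, $\xi\in\mathcal F_s$ and $g\in G$ with $g\xi\in\mathcal F_{s'}$, let $\beta_{s',s}(g,\xi)$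 be the unique element of $AM$ with $gs(\xi)\in s'(g\xi)\,\beta_{s',s}(g,\xi)\,N$. **Proposition.** Let $s$ be a compact valued differentiable cross-section of $G\to\mathcal F$. Then $\mathcal H_s$ is a bijection, so that each $(\xi,\check\xi;x)\in\mathcal F_s^{(2)}\times AM$ is the coordinate of a unique element of $s(\mathcal F_s)NAM$, denoted $(\xi,\check\xi;x)_s$, and the following hold. 1. $\mathcal H_s$ extends the Hopf coordinates: for $h=(\xi,\check\xi;x)_s$ in $s(\mathcal F_s)NAM$, the Hopf coordinates of $hM$ are $(\xi,\check\xi;\log x_A)$. 2. (Left action of $G$.) Let $s'$ be a compact valued differentiable cross-section, $\xi\in\mathcal F_s$, and $g\in G$ with $g\xi\in\mathcal F_{s'}$. Then $\log\big(\beta_{s',s}(g,\xi)_A\big)=\sigma(g,\xi)$. For all $\check\xi$ with $(\xi,\check\xi)\in\mathcal F_s^{(2)}$ and all $x\in AM$, the element $g\,(\xi,\check\xi;x)_s$ lies in $s'(\mathcal F_{s'})NAM$ and $$g\,(\xi,\check\xi;x)_s=(g\xi,g\check\xi;\beta_{s',s}(g,\xi)x)_{s'},$$ and it projects in $G/M$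 to the $g$-translate of the point with Hopf coordinates $(\xi,\check\xi;\log x_A)$, which has Hopf coordinates $$g\,(\xi,\check\xi;\log x_A)=(g\xi,g\check\xi;\sigma(g,\xi)+\log x_A).$$ 3. (Right action of $A$.) For all $(\xi,\check\xi;x)\in\mathcal F_s^{(2)}\times AM$, $\theta\in\mathfrak a$ and $t\in\mathbb R$, the element $\tilde\phi_\theta^t(\xi,\check\xi;x)_s$ lies in $s(\mathcal F_s)NAM$ and $$\tilde\phi_\theta^t(\xi,\check\xi;x)_s=(\xi,\check\xi;xe^{t\theta})_s,$$ and it projects in $G/M$ to $$\tilde\phi_\theta^t(\xi,\check\xi;\log x_A)=(\xi,\check\xi;\log x_A+t\theta).$$ -/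

import Mathlib

open Filter Topology

/- Matrices carry the commutator bracket. -/
attribute [local instance] LieRing.ofAssociativeRing

/-! ### The matrix exponential and the Lie algebra of a closed linear group -/

/-- The Lie product formula. -/
theorem lie_product_formula_aux {R : Type*} [NormedRing R] [NormedAlgebra ℝ R] [NormOneClass R]
    [CompleteSpace R] (X Y : R) :
    Tendsto (fun k : ℕ => (NormedSpace.exp (((k : ℝ) + 1)⁻¹ • X) *
      NormedSpace.exp (((k : ℝ) + 1)⁻¹ • Y)) ^ (k + 1)) atTop
      (𝓝 (NormedSpace.exp (X + Y))) := by
  let _ : NormedAlgebra ℚ R := NormedAlgebra.restrictScalars ℚ ℝ R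
  set P : ℝ → R := fun t => NormedSpace.exp (t • X) * NormedSpace.exp (t • Y) with hP
  set Q : ℝ → R := fun t => NormedSpace.exp (t • (X + Y)) with hQ
  have hd : HasDerivAt (fun t => P t - Q t) 0 0 := by
    have h1 := (hasDerivAt_exp_smul_const (𝕂 := ℝ) X 0).mul
      (hasDerivAt_exp_smul_const (𝕂 := ℝ) Y 0)
    have h2 := h1.sub (hasDerivAt_exp_smul_const (𝕂 := ℝ) (X + Y) 0)
    convert! h2 using 1
    simp
  set c : ℝ := ‖X‖ + ‖Y‖ with hc
  have hnorm : ∀ Z : R, ‖NormedSpace.exp Z‖ ≤ Real.exp ‖Z‖ := fun Z => by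
    have hs := NormedSpace.norm_expSeries_summable' (𝕂 := ℝ) Z
    rw [NormedSpace.exp_eq_tsum ℝ, Real.exp_eq_exp_ℝ, NormedSpace.exp_eq_tsum ℝ]
    refine (norm_tsum_le_tsum_norm hs).trans (Summable.tsum_le_tsum (fun m => ?_) hs
      (NormedSpace.expSeries_summable' (𝕂 := ℝ) ‖Z‖))
    rw [norm_smul, Real.norm_of_nonneg (by positivity), smul_eq_mul]
    gcongr
    exact norm_pow_le _ _
  have hPb : ∀ t : ℝ, 0 ≤ t → ‖P t‖ ≤ Real.exp (t * c) := by
    intro t ht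
    calc ‖P t‖ ≤ ‖NormedSpace.exp (t • X)‖ * ‖NormedSpace.exp (t • Y)‖ := norm_mul_le _ _
      _ ≤ Real.exp ‖t • X‖ * Real.exp ‖t • Y‖ := by gcongr <;> exact hnorm _
      _ = Real.exp (t * c) := by
        rw [← Real.exp_add, norm_smul, norm_smul, Real.norm_of_nonneg ht, hc, mul_add]
  have hQb : ∀ t : ℝ, 0 ≤ t → ‖Q t‖ ≤ Real.exp (t * c) := by
    intro t ht
    refine (hnorm _).trans (Real.exp_le_exp.2 ?_)
    rw [norm_smul, Real.norm_of_nonneg ht]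
    gcongr
    exact norm_add_le _ _
  have htel : ∀ (A B : R) (b : ℝ), 1 ≤ b → ‖A‖ ≤ b → ‖B‖ ≤ b → ∀ m : ℕ,
      ‖A ^ m - B ^ m‖ ≤ m * ‖A - B‖ * b ^ m := by
    intro A B b hb hA hB m
    induction m with
    | zero => simp
    | succ m ih =>
      have e : A ^ (m + 1) - B ^ (m + 1) = A ^ m * (A - B) + (A ^ m - B ^ m) * B := by
        rw [pow_succ, pow_succ]; noncomm_ring
      have hb0 : 0 ≤ b := by linarith
      have hAm : ‖A ^ m‖ ≤ b ^ (m + 1) :=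
        ((norm_pow_le A m).trans (pow_le_pow_left₀ (norm_nonneg _) hA m)).trans
          (pow_le_pow_right₀ hb (Nat.le_succ m))
      calc ‖A ^ (m + 1) - B ^ (m + 1)‖
          ≤ ‖A ^ m * (A - B)‖ + ‖(A ^ m - B ^ m) * B‖ := by rw [e]; exact norm_add_le _ _
        _ ≤ ‖A ^ m‖ * ‖A - B‖ + ‖A ^ m - B ^ m‖ * ‖B‖ :=
            add_le_add (norm_mul_le _ _) (norm_mul_le _ _)
        _ ≤ b ^ (m + 1) * ‖A - B‖ + (m * ‖A - B‖ * b ^ m) * b := by gcongr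
        _ = ((m + 1 : ℕ) : ℝ) * ‖A - B‖ * b ^ (m + 1) := by push_cast; ring
  have hpos : ∀ k : ℕ, (0 : ℝ) < ((k : ℝ) + 1)⁻¹ := fun k => by positivity
  have hseq : Tendsto (fun k : ℕ => ((k : ℝ) + 1)⁻¹) atTop (𝓝[≠] 0) := by
    refine tendsto_nhdsWithin_iff.2 ⟨?_, Eventually.of_forall fun k => (hpos k).ne'⟩
    simpa using tendsto_one_div_add_atTop_nhds_zero_nat (𝕜 := ℝ)
  have hlim : Tendsto (fun k : ℕ => ((k : ℝ) + 1) *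
      ‖P (((k : ℝ) + 1)⁻¹) - Q (((k : ℝ) + 1)⁻¹)‖ * Real.exp c) atTop (𝓝 0) := by
    have h1 := (hasDerivAt_iff_tendsto_slope_zero.1 hd).comp hseq
    have h2 := (h1.norm).mul_const (Real.exp c)
    rw [norm_zero, zero_mul] at h2
    refine h2.congr fun k => ?_
    have hk : (0 : ℝ) < (k : ℝ) + 1 := by positivity
    simp [hP, hQ, norm_smul, abs_of_pos hk]
  rw [tendsto_iff_norm_sub_tendsto_zero]
  refine squeeze_zero (fun _ => norm_nonneg _) (fun k => ?_) hlim
  have hk : (0 : ℝ) < (k : ℝ) + 1 := by positivity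
  have hQk : NormedSpace.exp (X + Y) = Q (((k : ℝ) + 1)⁻¹) ^ (k + 1) := by
    rw [hQ, ← NormedSpace.exp_nsmul, ← Nat.cast_smul_eq_nsmul ℝ, smul_smul]
    push_cast
    rw [mul_inv_cancel₀ hk.ne', one_smul]
  have hcn : 0 ≤ c := by positivity
  have := htel (P (((k : ℝ) + 1)⁻¹)) (Q (((k : ℝ) + 1)⁻¹)) (Real.exp (((k : ℝ) + 1)⁻¹ * c))
    (Real.one_le_exp (mul_nonneg (hpos k).le hcn)) (hPb _ (hpos k).le) (hQb _ (hpos k).le) (k + 1)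
  rw [hQk]
  refine this.trans (le_of_eq ?_)
  rw [← Real.exp_nat_mul]
  push_cast
  rw [← mul_assoc ((k : ℝ) + 1) _ c, mul_inv_cancel₀ hk.ne', one_mul]

namespace Matrix

open scoped Matrix.Norms.Operator in
theorem lie_product_formula {n : ℕ} (X Y : Matrix (Fin n) (Fin n) ℝ) :
    Tendsto (fun k : ℕ => (NormedSpace.exp (((k : ℝ) + 1)⁻¹ • X) *
      NormedSpace.exp (((k : ℝ) + 1)⁻¹ • Y)) ^ (k + 1)) atTop
      (𝓝 (NormedSpace.exp (X + Y))) := by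
  rcases n with _ | n
  · rw [Subsingleton.elim (NormedSpace.exp (X + Y)) 1]
    exact tendsto_const_nhds.congr fun k => Subsingleton.elim _ _
  · exact lie_product_formula_aux X Y

/-- The exponential `M_n(ℝ) → GL_n(ℝ)`. -/
noncomputable def expGL {n : ℕ} (X : Matrix (Fin n) (Fin n) ℝ) : GL (Fin n) ℝ where
  val := NormedSpace.exp X
  inv := NormedSpace.exp (-X)
  val_inv := by
    rw [← exp_add_of_commute _ _ (Commute.refl X).neg_right]; simp
  inv_val := by
    rw [← exp_add_of_commute _ _ (Commute.refl X).neg_left]; simp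

theorem expGL_add {n : ℕ} {X Y : Matrix (Fin n) (Fin n) ℝ} (h : Commute X Y) :
    expGL (X + Y) = expGL X * expGL Y :=
  Units.ext (exp_add_of_commute X Y h)

theorem expGL_zero {n : ℕ} : expGL (0 : Matrix (Fin n) (Fin n) ℝ) = 1 :=
  Units.ext (by simp [expGL])

theorem expGL_neg {n : ℕ} (X : Matrix (Fin n) (Fin n) ℝ) : expGL (-X) = (expGL X)⁻¹ :=
  Units.ext rfl

theorem expGL_add_mem {n : ℕ} {H : Subgroup (GL (Fin n) ℝ)}
    (hH : IsClosed (H : Set (GL (Fin n) ℝ))) {X Y : Matrix (Fin n) (Fin n) ℝ}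
    (hX : ∀ t : ℝ, expGL (t • X) ∈ H) (hY : ∀ t : ℝ, expGL (t • Y) ∈ H) :
    expGL (X + Y) ∈ H := by
  refine hH.mem_of_tendsto (f := fun k : ℕ =>
    (expGL (((k : ℝ) + 1)⁻¹ • X) * expGL (((k : ℝ) + 1)⁻¹ • Y)) ^ (k + 1)) (b := atTop) ?_
    (Eventually.of_forall fun k => H.pow_mem (H.mul_mem (hX _) (hY _)) _)
  rw [Units.isInducing_embedProduct.tendsto_nhds_iff, Prod.tendsto_iff]
  refine ⟨lie_product_formula X Y, ?_⟩
  refine (MulOpposite.continuous_op.tendsto _).comp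
    (f := fun k : ℕ => (((expGL (((k : ℝ) + 1)⁻¹ • X) * expGL (((k : ℝ) + 1)⁻¹ • Y)) ^ (k + 1))⁻¹ :
      GL (Fin n) ℝ).val) (y := 𝓝 ((expGL (X + Y))⁻¹ : GL (Fin n) ℝ).val) ?_
  have h := lie_product_formula (-Y) (-X)
  have e : -Y + -X = -(X + Y) := by abel
  rw [e] at h
  refine h.congr fun k => ?_
  have e2 : ((expGL (((k : ℝ) + 1)⁻¹ • X) * expGL (((k : ℝ) + 1)⁻¹ • Y)) ^ (k + 1))⁻¹ =
      (expGL (((k : ℝ) + 1)⁻¹ • (-Y)) * expGL (((k : ℝ) + 1)⁻¹ • (-X))) ^ (k + 1) := by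
    rw [smul_neg, smul_neg, expGL_neg, expGL_neg, ← inv_pow, _root_.mul_inv_rev]
  rw [e2]
  rfl

theorem expGL_conj {n : ℕ} (g : GL (Fin n) ℝ) (X : Matrix (Fin n) (Fin n) ℝ) :
    expGL ((g : Matrix (Fin n) (Fin n) ℝ) * X * ((g⁻¹ : GL (Fin n) ℝ) : Matrix (Fin n) (Fin n) ℝ)) =
      g * expGL X * g⁻¹ :=
  Units.ext (exp_units_conj g X)

end Matrix

open Matrix

namespace ClosedSubgroup

variable {d : ℕ} (G : ClosedSubgroup (GL (Fin d) ℝ))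

/-- The space of `X` with `exp (tX) ∈ G` for all real `t`. -/
noncomputable def lieSpace : Submodule ℝ (Matrix (Fin d) (Fin d) ℝ) where
  carrier := {X | ∀ t : ℝ, expGL (t • X) ∈ G.toSubgroup}
  zero_mem' := fun t => by
    rw [smul_zero, expGL_zero]; exact G.toSubgroup.one_mem
  add_mem' := fun {X Y} hX hY t => by
    rw [smul_add]
    refine expGL_add_mem G.isClosed' (fun r => ?_) (fun r => ?_)
    · rw [smul_smul]; exact hX _
    · rw [smul_smul]; exact hY _
  smul_mem' := fun c X hX t => by
    rw [smul_smul]; exact hX _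

theorem conj_mem_lieSpace {g : GL (Fin d) ℝ} (hg : g ∈ G.toSubgroup)
    {X : Matrix (Fin d) (Fin d) ℝ} (hX : X ∈ G.lieSpace) :
    (g : Matrix (Fin d) (Fin d) ℝ) * X * ((g⁻¹ : GL (Fin d) ℝ) : Matrix (Fin d) (Fin d) ℝ) ∈
      G.lieSpace := fun t => by
  have e : t • ((g : Matrix (Fin d) (Fin d) ℝ) * X *
      ((g⁻¹ : GL (Fin d) ℝ) : Matrix (Fin d) (Fin d) ℝ)) =
      (g : Matrix (Fin d) (Fin d) ℝ) * (t • X) *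
        ((g⁻¹ : GL (Fin d) ℝ) : Matrix (Fin d) (Fin d) ℝ) := by simp
  rw [e, expGL_conj]
  exact G.toSubgroup.mul_mem (G.toSubgroup.mul_mem hg (hX t)) (G.toSubgroup.inv_mem hg)

open scoped Matrix.Norms.Operator in
theorem lie_mem_lieSpace {X Y : Matrix (Fin d) (Fin d) ℝ} (hX : X ∈ G.lieSpace)
    (hY : Y ∈ G.lieSpace) : ⁅X, Y⁆ ∈ G.lieSpace := by
  have hd : HasDerivAt (fun t : ℝ => NormedSpace.exp (t • X) * Y * NormedSpace.exp (t • (-X)))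
      ⁅X, Y⁆ 0 := by
    have h := ((hasDerivAt_exp_smul_const (𝕂 := ℝ) X 0).mul_const Y).mul
      (hasDerivAt_exp_smul_const (𝕂 := ℝ) (-X) 0)
    convert! h using 1
    simp [Ring.lie_def, sub_eq_add_neg]
  have hc : IsClosed (G.lieSpace : Set (Matrix (Fin d) (Fin d) ℝ)) :=
    Submodule.closed_of_finiteDimensional _
  refine hc.mem_of_tendsto (hasDerivAt_iff_tendsto_slope_zero.1 hd)
    (Eventually.of_forall fun t => G.lieSpace.smul_mem _ (G.lieSpace.sub_mem ?_ ?_))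
  · have := G.conj_mem_lieSpace (hX t) hY
    rw [zero_add, smul_neg]
    exact this
  · simpa using hY

/-- The Lie algebra `𝔤` of a closed subgroup `G` of `GL_n(ℝ)`. -/
noncomputable def lieAlgebra : LieSubalgebra ℝ (Matrix (Fin d) (Fin d) ℝ) where
  __ := G.lieSpace
  lie_mem' := G.lie_mem_lieSpace

/-- The group `G` as a type. -/
abbrev Pt : Type := G.toSubgroup

/-- The exponential map `𝔤 → G`. -/
noncomputable def exp (X : G.lieAlgebra) : G.Pt :=
  ⟨expGL (X : Matrix (Fin d) (Fin d) ℝ), by simpa using X.2 1⟩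

theorem exp_zero : G.exp 0 = 1 := Subtype.ext expGL_zero

theorem exp_neg (X : G.lieAlgebra) : G.exp (-X) = (G.exp X)⁻¹ :=
  Subtype.ext (expGL_neg _)

theorem exp_add {X Y : G.lieAlgebra} (h : ⁅X, Y⁆ = 0) : G.exp (X + Y) = G.exp X * G.exp Y :=
  Subtype.ext <| expGL_add <| by
    have := congrArg (fun Z : G.lieAlgebra => (Z : Matrix (Fin d) (Fin d) ℝ)) h
    simpa [Ring.lie_def, sub_eq_zero, Commute, SemiconjBy] using this

/-- The adjoint action `Ad g X = g X g⁻¹` of `G` on `𝔤`. -/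
noncomputable def Ad (g : G.Pt) (X : G.lieAlgebra) : G.lieAlgebra :=
  ⟨((g : GL (Fin d) ℝ) : Matrix (Fin d) (Fin d) ℝ) * X *
    (((g : GL (Fin d) ℝ)⁻¹ : GL (Fin d) ℝ) : Matrix (Fin d) (Fin d) ℝ),
    G.conj_mem_lieSpace g.2 X.2⟩

/-- The Lie algebra, inside `𝔤`, of a closed subgroup `H` of `G`. -/
noncomputable def lieOf (H : Subgroup G.Pt) (hH : IsClosed (H : Set G.Pt)) :
    Submodule ℝ G.lieAlgebra where
  carrier := {X | ∀ t : ℝ, G.exp (t • X) ∈ H}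
  zero_mem' := fun t => by
    rw [smul_zero, exp_zero]; exact H.one_mem
  add_mem' := fun {X Y} hX hY t => by
    have hc : IsClosed ((H.map G.toSubgroup.subtype : Subgroup (GL (Fin d) ℝ)) :
        Set (GL (Fin d) ℝ)) := by
      rw [Subgroup.coe_map]
      exact G.isClosed'.isClosedEmbedding_subtypeVal.isClosedMap _ hH
    have := expGL_add_mem hc (X := t • (X : Matrix (Fin d) (Fin d) ℝ))
      (Y := t • (Y : Matrix (Fin d) (Fin d) ℝ))
      (fun r => ⟨_, hX (r * t), by simp [exp, smul_smul]⟩)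
      (fun r => ⟨_, hY (r * t), by simp [exp, smul_smul]⟩)
    obtain ⟨h, hh, he⟩ := this
    have e : h = G.exp (t • (X + Y)) := Subtype.ext (by
      rw [show ((h : GL (Fin d) ℝ)) = _ from he]; simp [exp])
    exact e ▸ hh
  smul_mem' := fun c X hX t => by
    rw [smul_smul]; exact hX _

/-- `𝔤` has no nonzero compact ideal: no nonzero ideal on which the Killing form of `𝔤` is negative
definite. For semisimple `𝔤` this says that `𝔤` (or `G`) is of non-compact type. -/
def NoCompactFactor : Prop :=
  ∀ I : LieIdeal ℝ G.lieAlgebra,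
    (∀ X ∈ I, X ≠ 0 → killingForm ℝ G.lieAlgebra X X < 0) → I = ⊥

/-- `𝔤 = 𝔨 ⊕ 𝔭` is a Cartan decomposition: the map that is `1` on `𝔨` and `-1` on `𝔭` is a Lie
algebra automorphism, and the Killing form is negative definite on `𝔨` and positive definite
on `𝔭`. -/
structure IsCartanDecomposition (k p : Submodule ℝ G.lieAlgebra) : Prop where
  isCompl : IsCompl k p
  lie_k_k : ∀ X ∈ k, ∀ Y ∈ k, ⁅X, Y⁆ ∈ k
  lie_k_p : ∀ X ∈ k, ∀ Y ∈ p, ⁅X, Y⁆ ∈ p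
  lie_p_p : ∀ X ∈ p, ∀ Y ∈ p, ⁅X, Y⁆ ∈ k
  neg_k : ∀ X ∈ k, X ≠ 0 → killingForm ℝ G.lieAlgebra X X < 0
  pos_p : ∀ X ∈ p, X ≠ 0 → 0 < killingForm ℝ G.lieAlgebra X X

/-- The simultaneous eigenspace `𝔤_α` of `ad 𝔞` for a linear form `α` on `𝔞`. -/
def rootSpace (a : Submodule ℝ G.lieAlgebra) (α : Module.Dual ℝ a) :
    Submodule ℝ G.lieAlgebra where
  carrier := {v | ∀ u : a, ⁅(u : G.lieAlgebra), v⁆ = α u • v}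
  zero_mem' := fun u => by simp
  add_mem' := fun {v w} hv hw u => by rw [lie_add, hv u, hw u, smul_add]
  smul_mem' := fun c v hv u => by rw [lie_smul, hv u, smul_comm]

/-- The set `Σ` of restricted roots. -/
def roots (a : Submodule ℝ G.lieAlgebra) : Set (Module.Dual ℝ a) :=
  {α | α ≠ 0 ∧ G.rootSpace a α ≠ ⊥}

/-- The complement in `𝔞` of the root hyperplanes. -/
def regularSet (a : Submodule ℝ G.lieAlgebra) : Set a :=
  {X | ∀ α ∈ G.roots a, α X ≠ 0}

/-- The choices that enter the structure theory of `G`: a maximal compact subgroup `K`, a Cartan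
decomposition `𝔤 = 𝔨 ⊕ 𝔭`, a Cartan subspace `𝔞` of `𝔭`, an (open) Weyl chamber of `𝔞`, and an
element `k_ι` of the normalizer of `𝔞` in `K` representing the element of the Weyl group that sends
the closed chamber `𝔞⁺` to `-𝔞⁺`. -/
structure CartanData where
  K : Subgroup G.Pt
  maximal_K : Maximal (fun H : Subgroup G.Pt => IsCompact (H : Set G.Pt)) K
  p : Submodule ℝ G.lieAlgebra
  cartan : G.IsCartanDecomposition (G.lieOf K maximal_K.prop.isClosed) p
  a : Submodule ℝ G.lieAlgebra
  maximal_a : Maximal (fun b : Submodule ℝ G.lieAlgebra => b ≤ p ∧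
    (∀ X ∈ b, ∀ Y ∈ b, ⁅X, Y⁆ = 0) ∧
    ∀ X ∈ b, (LieAlgebra.ad ℝ G.lieAlgebra X).IsSemisimple) a
  chamber : Set a
  isChamber : ∃ X ∈ G.regularSet a, chamber = connectedComponentIn (G.regularSet a) X
  kι : G.Pt
  kι_mem : kι ∈ K
  Ad_kι_a : G.Ad kι '' (a : Set G.lieAlgebra) = a
  Ad_kι : G.Ad kι '' (Subtype.val '' closure chamber) = -(Subtype.val '' closure chamber)

namespace CartanData

variable {G} (D : G.CartanData)

theorem lie_a {X Y : G.lieAlgebra} (hX : X ∈ D.a) (hY : Y ∈ D.a) : ⁅X, Y⁆ = 0 :=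
  D.maximal_a.prop.2.1 X hX Y hY

/-- The set `Σ⁺` of positive roots. -/
def posRoots : Set (Module.Dual ℝ D.a) :=
  {α | α ∈ G.roots D.a ∧ ∀ X ∈ D.chamber, 0 < α X}

/-- `𝔫 = ⨁_{α ∈ Σ⁺} 𝔤_α`. -/
noncomputable def n : Submodule ℝ G.lieAlgebra :=
  ⨆ α ∈ D.posRoots, G.rootSpace D.a α

/-- `A = exp 𝔞`. -/
def A : Subgroup G.Pt where
  carrier := {g | ∃ X ∈ D.a, g = G.exp X}
  one_mem' := ⟨0, D.a.zero_mem, G.exp_zero.symm⟩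
  mul_mem' := by
    rintro _ _ ⟨X, hX, rfl⟩ ⟨Y, hY, rfl⟩
    exact ⟨X + Y, D.a.add_mem hX hY, (G.exp_add (D.lie_a hX hY)).symm⟩
  inv_mem' := by
    rintro _ ⟨X, hX, rfl⟩
    exact ⟨-X, D.a.neg_mem hX, (G.exp_neg X).symm⟩

/-- `N`: the connected subgroup with Lie algebra `𝔫`, i.e. the subgroup generated by `exp 𝔫`
(which is the set `exp 𝔫`, as `𝔫` is nilpotent). -/
def N : Subgroup G.Pt :=
  Subgroup.closure {g | ∃ X ∈ D.n, g = G.exp X}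

/-- `M`: the centralizer of `A` in `K`. -/
def M : Subgroup G.Pt :=
  Subgroup.centralizer (D.A : Set G.Pt) ⊓ D.K

/-- The subgroup `AM`. -/
def AM : Subgroup G.Pt := D.A ⊔ D.M

/-- The subgroup `MAN`. -/
def MAN : Subgroup G.Pt := D.M ⊔ D.A ⊔ D.N

theorem M_le_MAN : D.M ≤ D.MAN := le_sup_left.trans le_sup_left

theorem AM_le_MAN : D.AM ≤ D.MAN := sup_le (le_sup_right.trans le_sup_left) D.M_le_MAN

theorem N_le_MAN : D.N ≤ D.MAN := le_sup_right

theorem commute_of_mem_M {m x : G.Pt} (hm : m ∈ D.M) (hx : x ∈ D.A) : x * m = m * x :=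
  Subgroup.mem_centralizer_iff.1 hm.1 x hx

/-! ### The Furstenberg boundary and the Iwasawa cocycle -/

/-- The Furstenberg boundary `𝓕 = G / MAN`, with the left action of `G` and the quotient
topology. -/
abbrev F : Type := G.Pt ⧸ D.MAN

/-- The base point `η₀ = MAN`. -/
def η : D.F := QuotientGroup.mk 1

/-- The opposite base point `η̌₀ = k_ι η₀`. -/
def ηop : D.F := D.kι • D.η

/-- The transverse pairs `𝓕⁽²⁾`. -/
def F2 : Set (D.F × D.F) := {q | ∃ g : G.Pt, q = (g • D.η, g • D.ηop)}

/-- The property that characterizes `σ(g, ξ)`: for all `k ∈ K` with `k η₀ = ξ`,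
`g k ∈ K exp(X) N`. -/
def IsIwasawa (g : G.Pt) (ξ : D.F) (X : D.a) : Prop :=
  ∀ k ∈ D.K, k • D.η = ξ → ∃ k' ∈ D.K, ∃ u ∈ D.N, g * k = k' * G.exp X * u

/-- The Iwasawa cocycle `σ : G × 𝓕 → 𝔞`. -/
noncomputable def σ (g : G.Pt) (ξ : D.F) : D.a :=
  Classical.epsilon (D.IsIwasawa g ξ)

/-- `log x_A` for `x ∈ AM`: the element `X` of `𝔞` with `x ∈ exp(X) M`. -/
noncomputable def logA (x : D.AM) : D.a :=
  Classical.epsilon fun X : D.a => ∃ m ∈ D.M, (x : G.Pt) = G.exp X * m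

theorem smul_η_of_mem {b : G.Pt} (hb : b ∈ D.MAN) : b • D.η = D.η := by
  change (QuotientGroup.mk (b * 1) : D.F) = QuotientGroup.mk 1
  rw [QuotientGroup.eq]
  simpa using hb

theorem isIwasawa_mul_M (h : G.Pt) {m : G.Pt} (hm : m ∈ D.M) (X : D.a)
    (hX : D.IsIwasawa h D.η X) : D.IsIwasawa (h * m) D.η X := by
  intro k hk hkη
  rw [mul_assoc]
  refine hX (m * k) (D.K.mul_mem hm.2 hk) ?_
  rw [mul_smul, hkη, D.smul_η_of_mem (D.M_le_MAN hm)]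

theorem σ_mul_M (h : G.Pt) {m : G.Pt} (hm : m ∈ D.M) : D.σ (h * m) D.η = D.σ h D.η := by
  unfold σ
  congr 1
  funext X
  refine propext ⟨fun hX => ?_, D.isIwasawa_mul_M h hm X⟩
  simpa using D.isIwasawa_mul_M (h * m) (D.M.inv_mem hm) X hX

/-! ### Hopf coordinates -/

theorem conj_kι_mem_A {x : G.Pt} (hx : x ∈ D.A) : D.kι * x * D.kι⁻¹ ∈ D.A := by
  obtain ⟨X, hX, rfl⟩ := hx
  have h : G.Ad D.kι X ∈ (D.a : Set G.lieAlgebra) := by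
    rw [← D.Ad_kι_a]; exact ⟨X, hX, rfl⟩
  exact ⟨_, h, (Subtype.ext (expGL_conj _ _)).symm⟩

theorem conj_kι_mem_M {m : G.Pt} (hm : m ∈ D.M) : D.kι⁻¹ * m * D.kι ∈ D.M := by
  refine ⟨Subgroup.mem_centralizer_iff.2 fun x hx => ?_,
    D.K.mul_mem (D.K.mul_mem (D.K.inv_mem D.kι_mem) hm.2) D.kι_mem⟩
  have h := D.commute_of_mem_M hm (D.conj_kι_mem_A hx)
  have h2 := congrArg (fun y => D.kι⁻¹ * y * D.kι) h
  simpa [mul_assoc] using h2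

theorem smul_ηop_of_mem {m : G.Pt} (hm : m ∈ D.M) : m • D.ηop = D.ηop := by
  have h := D.smul_η_of_mem (D.M_le_MAN (D.conj_kι_mem_M hm))
  have h2 := congrArg (fun y : D.F => D.kι • y) h
  simpa [ηop, smul_smul, mul_assoc] using h2

/-- The Hopf coordinates `G/M → 𝓕⁽²⁾ × 𝔞`, `hM ↦ (h η₀, h η̌₀ ; σ(h, η₀))`. -/
noncomputable def hopf : G.Pt ⧸ D.M → D.F2 × D.a :=
  Quotient.lift (fun h : G.Pt => (⟨(h • D.η, h • D.ηop), h, rfl⟩, D.σ h D.η)) fun h h' hh => by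
    have hm : h⁻¹ * h' ∈ D.M := QuotientGroup.leftRel_apply.1 hh
    obtain ⟨m, hm', rfl⟩ : ∃ m ∈ D.M, h' = h * m := ⟨_, hm, by group⟩
    have h1 : (h * m) • D.η = h • D.η := by
      rw [mul_smul, D.smul_η_of_mem (D.M_le_MAN hm')]
    have h2 : (h * m) • D.ηop = h • D.ηop := by rw [mul_smul, D.smul_ηop_of_mem hm']
    refine Prod.ext (Subtype.ext (Prod.ext h1.symm h2.symm)) (D.σ_mul_M h hm').symm

/-- `exp X`, for `X ∈ 𝔞`, as an element of `AM`. -/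
noncomputable def expA (X : D.a) : D.AM :=
  ⟨G.exp X, Subgroup.mem_sup_left ⟨X, X.2, rfl⟩⟩

/-- The flow `φ̃_θ^t` on `G`: right multiplication by `exp(tθ)`. -/
noncomputable def flow (θ : D.a) (t : ℝ) (h : G.Pt) : G.Pt := h * D.expA (t • θ)

/-- The Weyl chamber flow `φ̃_θ^t` on `G/M`: right multiplication by `exp(tθ)`. -/
noncomputable def weylFlow (θ : D.a) (t : ℝ) : G.Pt ⧸ D.M → G.Pt ⧸ D.M :=
  Quotient.map (D.flow θ t) fun h h' hh => by
    have hm : h⁻¹ * h' ∈ D.M := QuotientGroup.leftRel_apply.1 hh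
    refine QuotientGroup.leftRel_apply.2 ?_
    have hA : ((D.expA (t • θ) : D.AM) : G.Pt) ∈ D.A := ⟨_, (t • θ).2, rfl⟩
    have e : (D.flow θ t h)⁻¹ * D.flow θ t h' = h⁻¹ * h' := by
      have := D.commute_of_mem_M hm hA
      simp only [flow, _root_.mul_inv_rev, mul_assoc]
      rw [← mul_assoc h⁻¹ h', ← this]
      simp
    rw [e]; exact hm

/-! ### Cross-sections, the associated coordinates and cocycles -/

/-- A differentiable (local) cross-section `s` of `G → 𝓕`, defined on an open subset `𝓕_s` of `𝓕`
(the values of `toFun` outside `𝓕_s` are irrelevant). Differentiability is that of the map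
`g ↦ s(g η₀)` on the preimage of `𝓕_s` in `G`, read in the exponential chart
`X ↦ g exp X` around each `g`; as `G → 𝓕` is a submersion, this is differentiability of `s`. -/
structure CrossSection where
  dom : Set D.F
  isOpen_dom : IsOpen dom
  toFun : D.F → G.Pt
  mk_toFun : ∀ ξ ∈ dom, (QuotientGroup.mk (toFun ξ) : D.F) = ξ
  differentiable : ∀ g : G.Pt, (QuotientGroup.mk g : D.F) ∈ dom →
    DifferentiableAt ℝ (fun X : G.lieAlgebra =>
      ((toFun (QuotientGroup.mk (g * G.exp X)) : GL (Fin d) ℝ) : Matrix (Fin d) (Fin d) ℝ)) 0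

namespace CrossSection

variable {D} (s : D.CrossSection)

/-- `s` is compact valued: it takes its values in `K`. -/
def CompactValued : Prop := ∀ ξ ∈ s.dom, s.toFun ξ ∈ D.K

/-- The subset `s(𝓕_s)NAM` of `G`. -/
def cell : Set G.Pt :=
  {g | ∃ ξ ∈ s.dom, ∃ u ∈ D.N, ∃ x ∈ D.AM, g = s.toFun ξ * u * x}

/-- `𝓕_s⁽²⁾`: the transverse pairs with first entry in `𝓕_s`. -/
def F2 : Set (D.F × D.F) := {q | q.1 ∈ s.dom ∧ q ∈ D.F2}

theorem smul_η_mem_dom {g : G.Pt} (hg : g ∈ s.cell) : g • D.η ∈ s.dom := by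
  obtain ⟨ξ, hξ, u, hu, x, hx, rfl⟩ := hg
  rw [mul_smul, mul_smul, D.smul_η_of_mem (D.AM_le_MAN hx), D.smul_η_of_mem (D.N_le_MAN hu)]
  have : s.toFun ξ • D.η = ξ := by
    conv_rhs => rw [← s.mk_toFun ξ hξ]
    change (QuotientGroup.mk (s.toFun ξ * 1) : D.F) = _
    rw [mul_one]
  rwa [this]

/-- The last coordinate of `g = s(ξ)ux`: the element `x` of `AM`. -/
noncomputable def lastCoord (g : G.Pt) : D.AM :=
  Classical.epsilon fun x : D.AM => ∃ ξ ∈ s.dom, ∃ u ∈ D.N, g = s.toFun ξ * u * x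

/-- The coordinate map `s(𝓕_s)NAM → 𝓕_s⁽²⁾ × AM`, `g = s(ξ)ux ↦ (g η₀, g η̌₀ ; x)_s`. -/
noncomputable def coord (g : s.cell) : s.F2 × D.AM :=
  (⟨((g : G.Pt) • D.η, (g : G.Pt) • D.ηop), s.smul_η_mem_dom g.2, g, rfl⟩, s.lastCoord g)

/-- The projection `𝓕_s⁽²⁾ × AM → 𝓕⁽²⁾ × 𝔞`, `(ξ, ξ̌ ; x)_s ↦ (ξ, ξ̌ ; log x_A)`. -/
noncomputable def toHopf (c : s.F2 × D.AM) : D.F2 × D.a :=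
  (⟨c.1, c.1.2.2⟩, D.logA c.2)

/-- The cocycle `β_{s',s}(g, ξ)`: the element `b` of `AM` with `g s(ξ) ∈ s'(gξ) b N`. -/
noncomputable def β (s' s : D.CrossSection) (g : G.Pt) (ξ : D.F) : D.AM :=
  Classical.epsilon fun b : D.AM => ∃ u ∈ D.N, g * s.toFun ξ = s'.toFun (g • ξ) * b * u

end CrossSection

end CartanData

end ClosedSubgroup

/-! Everything is read off from one factorization, `g = s(ξ) u x`. Since `s(ξ)` lies in `K` and `AM`
normalizes `N`, moving `x` past `u` gives an Iwasawa decomposition of `g`, so `log x_A` is the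
Iwasawa cocycle. Left translation by `g` replaces `g s(ξ)` by `s'(gξ) β v` with `v ∈ N`, and
conjugating by `β` restores the normal form with last coordinate `β x`. Right multiplication by
`exp(tθ)` only changes `x`. Existence of Iwasawa decompositions is never needed in general: the
sections supply the `K`-factor. What carries the proof is uniqueness, in two forms.

The first is `K ∩ AN = 1` (`eq_one_of_exp_mul_mem_K`). If `exp(X) u ∈ K`, its powers have bounded
`Ad`-trace; conjugating by the chamber flow removes `u` from the trace, leaving `∑ exp(k c_i)` with
`c_i` the real eigenvalues of `ad X` (`IsCartanDecomposition.exists_basis`). The inverse gives the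
opposite bound, so `ad X = 0`, and semisimplicity gives `X = 0`. Then `u` is unipotent with bounded
powers, hence trivial.

The second is that `N` meets `MA(k_ι N k_ι⁻¹)` trivially (`eq_one_of_eq_mul_conj_kι`), which makes
`(g η₀, g η̌₀)` determine the `N`-factor. Conjugation along the chamber flow converges in both time
directions for such an element, while an exponential with the same finite limit at both ends is
constant. Both rest on the contraction `tendsto_conj_of_mem_N`. -/

/-! ### Diagonalization, exponentials and unipotent elements -/

/-- An endomorphism that is symmetric for a positive definite form has a basis of eigenvectors. -/
theorem LinearMap.exists_basis_eigenvectors {V : Type*} [AddCommGroup V] [Module ℝ V]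
    [FiniteDimensional ℝ V] (Q : V →ₗ[ℝ] V →ₗ[ℝ] ℝ) (hsymm : ∀ x y, Q x y = Q y x)
    (hpos : ∀ x, x ≠ 0 → 0 < Q x x) (T : V →ₗ[ℝ] V) (hT : ∀ x y, Q (T x) y = Q x (T y)) :
    ∃ (b : Module.Basis (Fin (Module.finrank ℝ V)) ℝ V) (c : Fin (Module.finrank ℝ V) → ℝ),
      ∀ i, T (b i) = c i • b i := by
  let core : InnerProductSpace.Core ℝ V :=
    { inner := fun x y => Q x y
      conj_inner_symm := fun x y => by simpa using hsymm y x
      re_inner_nonneg := fun x => by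
        rcases eq_or_ne x 0 with rfl | hx
        · simp
        · simpa using (hpos x hx).le
      add_left := fun x y z => by simp
      smul_left := fun x y r => by simp
      definite := fun x hx => by
        by_contra h
        exact (hpos x h).ne' hx }
  let _ : NormedAddCommGroup V := core.toNormedAddCommGroup
  let _ : InnerProductSpace ℝ V := InnerProductSpace.ofCore core.toCore
  have hS : T.IsSymmetric := fun x y => hT x y
  refine ⟨(hS.eigenvectorBasis rfl).toBasis, hS.eigenvalues rfl, fun i => ?_⟩
  simp

/-- The bracket relation says `Y (X + c) = X Y`, so `Y` also intertwines the exponentials of `X + c`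
and `X`, and the scalar `c` splits off as a factor. -/
theorem NormedSpace.exp_mul_mul_exp_neg_of_lie_eq_smul {R : Type*} [NormedRing R]
    [NormedAlgebra ℝ R] [CompleteSpace R] {X Y : R} {c : ℝ} (h : X * Y - Y * X = c • Y) :
    NormedSpace.exp X * Y * NormedSpace.exp (-X) = Real.exp c • Y := by
  let _ : NormedAlgebra ℚ R := NormedAlgebra.restrictScalars ℚ ℝ R
  have hs : SemiconjBy Y (X + c • 1) X := by
    simp only [SemiconjBy, mul_add, mul_smul_comm, mul_one, ← h]
    abel
  have h1 := hs.exp_right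
  have h2 : NormedSpace.exp (c • (1 : R)) = Real.exp c • 1 := by
    have := NormedSpace.algebraMap_exp_comm (𝕂 := ℝ) (𝔸 := R) c
    rw [Algebra.algebraMap_eq_smul_one, Algebra.algebraMap_eq_smul_one] at this
    rw [← this, Real.exp_eq_exp_ℝ]
  rw [NormedSpace.exp_add_of_commute ((Commute.one_right X).smul_right c), h2, mul_smul_comm,
    mul_one] at h1
  rw [← h1.eq, mul_assoc, smul_mul_assoc,
    ← NormedSpace.exp_add_of_commute (Commute.refl X).neg_right]
  simp

theorem NormedSpace.eq_of_exp_smul_eq {R : Type*} [NormedRing R] [NormedAlgebra ℝ R]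
    [CompleteSpace R] {X Y : R}
    (h : ∀ t : ℝ, NormedSpace.exp (t • X) = NormedSpace.exp (t • Y)) : X = Y := by
  have hX := hasDerivAt_exp_smul_const (𝕂 := ℝ) X 0
  rw [funext h] at hX
  simpa using hX.unique (hasDerivAt_exp_smul_const (𝕂 := ℝ) Y 0)

/-- A unipotent element with bounded powers is `1`. -/
theorem eq_one_of_unipotent_of_bounded {R : Type*} [NormedRing R] [NormedAlgebra ℝ R] {U : R}
    {m : ℕ} (hU : (U - 1) ^ m = 0) {C : ℝ} (hC : ∀ k : ℕ, ‖U ^ k‖ ≤ C) : U = 1 := by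
  classical
  by_contra hne
  have hex : ∃ m, (U - 1) ^ m = 0 := ⟨m, hU⟩
  -- The nilpotency index of `U - 1` is at least 2 when `U ≠ 1`; writing it `j + 2` avoids truncated
  -- subtraction.
  obtain ⟨j, hj⟩ : ∃ j, Nat.find hex = j + 2 := by
    have h0 : Nat.find hex ≠ 0 := fun h => by
      have := Nat.find_spec hex
      rw [h, pow_zero] at this
      exact hne ((mul_one U).symm.trans (by rw [this, mul_zero]))
    have h1 : Nat.find hex ≠ 1 := fun h => by
      have := Nat.find_spec hex
      rw [h, pow_one] at this
      exact hne (sub_eq_zero.1 this)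
    exact ⟨Nat.find hex - 2, by omega⟩
  have hz : (U - 1) ^ (j + 2) = 0 := hj ▸ Nat.find_spec hex
  have hnz : (U - 1) ^ (j + 1) ≠ 0 := Nat.find_min hex (by omega)
  -- Applied to `(U - 1) ^ j`, the binomial expansion of `U ^ k` stops after its linear term, so it
  -- grows linearly in `k`, against the bound on the powers.
  have hpow : ∀ k : ℕ, U ^ k * (U - 1) ^ j = (U - 1) ^ j + (k : ℝ) • (U - 1) ^ (j + 1) := by
    intro k
    induction k with
    | zero => simp
    | succ k ih =>
      have e1 : ∀ i, U * (U - 1) ^ i = (U - 1) ^ i + (U - 1) ^ (i + 1) := fun i => by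
        rw [pow_succ' (U - 1) i, sub_mul, one_mul]; abel
      rw [pow_succ', mul_assoc, ih, mul_add, mul_smul_comm, e1, e1, hz]
      push_cast
      rw [add_zero, add_smul, one_smul]
      abel
  have hbd : ∀ k : ℕ, (k : ℝ) * ‖(U - 1) ^ (j + 1)‖ ≤ C * ‖(U - 1) ^ j‖ + ‖(U - 1) ^ j‖ := by
    intro k
    have e : (k : ℝ) • (U - 1) ^ (j + 1) = U ^ k * (U - 1) ^ j - (U - 1) ^ j := by
      rw [hpow]; abel
    have h1 : ‖(k : ℝ) • (U - 1) ^ (j + 1)‖ ≤ C * ‖(U - 1) ^ j‖ + ‖(U - 1) ^ j‖ := by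
      rw [e]
      refine (norm_sub_le _ _).trans ?_
      gcongr
      exact (norm_mul_le _ _).trans (by gcongr; exact hC k)
    rwa [norm_smul, Real.norm_natCast] at h1
  obtain ⟨k, hk⟩ := exists_nat_gt
    ((C * ‖(U - 1) ^ j‖ + ‖(U - 1) ^ j‖) / ‖(U - 1) ^ (j + 1)‖)
  rw [div_lt_iff₀ (norm_pos_iff.2 hnz)] at hk
  exact (hbd k).not_gt hk

/-! ### Matrix versions -/

namespace Matrix

open scoped Matrix.Norms.Operator in
theorem continuous_exp {d : ℕ} :
    Continuous (NormedSpace.exp : Matrix (Fin d) (Fin d) ℝ → Matrix (Fin d) (Fin d) ℝ) :=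
  let _ : NormedAlgebra ℚ (Matrix (Fin d) (Fin d) ℝ) := NormedAlgebra.restrictScalars ℚ ℝ _
  NormedSpace.exp_continuous

theorem continuous_expGL {d : ℕ} :
    Continuous (expGL : Matrix (Fin d) (Fin d) ℝ → GL (Fin d) ℝ) :=
  Units.continuous_iff.2 ⟨continuous_exp, continuous_exp.comp continuous_neg⟩

open scoped Matrix.Norms.Operator in
theorem exp_mul_mul_exp_neg_of_lie_eq_smul {d : ℕ} {X Y : Matrix (Fin d) (Fin d) ℝ} {c : ℝ}
    (h : X * Y - Y * X = c • Y) :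
    NormedSpace.exp X * Y * NormedSpace.exp (-X) = Real.exp c • Y :=
  NormedSpace.exp_mul_mul_exp_neg_of_lie_eq_smul h

open scoped Matrix.Norms.Operator in
theorem eq_of_expGL_smul_eq {d : ℕ} {X Y : Matrix (Fin d) (Fin d) ℝ}
    (h : ∀ t : ℝ, expGL (t • X) = expGL (t • Y)) : X = Y :=
  NormedSpace.eq_of_exp_smul_eq fun t => congrArg Units.val (h t)

/-- A matrix whose conjugates accumulate at `1` is unipotent. -/
theorem sub_one_pow_eq_zero_of_tendsto_conj {d : ℕ} {u : GL (Fin d) ℝ} {a : ℝ → GL (Fin d) ℝ}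
    (h : Tendsto (fun t => a t * u * (a t)⁻¹) atTop (𝓝 1)) :
    ((u : Matrix (Fin d) (Fin d) ℝ) - 1) ^ d = 0 := by
  -- The characteristic polynomial is conjugation invariant and continuous, so it equals that of the
  -- limit `1`; Cayley–Hamilton then concludes.
  have hp : (u : Matrix (Fin d) (Fin d) ℝ).charpoly = (Polynomial.X - 1) ^ d := by
    refine Polynomial.funext fun r => ?_
    rw [Matrix.eval_charpoly]
    have hc : ∀ t, (Matrix.scalar (Fin d) r - (a t * u * (a t)⁻¹ : GL (Fin d) ℝ).val).det =
        (Matrix.scalar (Fin d) r - u.val).det := fun t => by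
      have e : Matrix.scalar (Fin d) r - (a t * u * (a t)⁻¹ : GL (Fin d) ℝ).val =
          (a t).val * (Matrix.scalar (Fin d) r - u.val) * (a t)⁻¹.val := by
        have := (Matrix.scalar_commute r (fun _ => Commute.all _ _) (a t).val).eq
        rw [mul_sub, sub_mul, ← this, mul_assoc (Matrix.scalar _ r)]
        simp
      rw [e, Matrix.det_units_conj]
    have hl : Tendsto (fun t => (Matrix.scalar (Fin d) r -
        (a t * u * (a t)⁻¹ : GL (Fin d) ℝ).val).det) atTop
        (𝓝 (Matrix.scalar (Fin d) r - (1 : GL (Fin d) ℝ).val).det) := by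
      have hcont : Continuous fun g : GL (Fin d) ℝ => (Matrix.scalar (Fin d) r - g.val).det :=
        (continuous_const.sub Units.continuous_val).matrix_det
      exact (hcont.tendsto 1).comp h
    simp only [hc] at hl
    rw [tendsto_nhds_unique tendsto_const_nhds hl]
    have : Matrix.scalar (Fin d) r - (1 : GL (Fin d) ℝ).val = Matrix.scalar (Fin d) (r - 1) := by
      rw [map_sub, map_one]; rfl
    rw [this]
    simp
  have := Matrix.aeval_self_charpoly (u : Matrix (Fin d) (Fin d) ℝ)
  rw [hp] at this
  simpa using this

open scoped Matrix.Norms.Operator in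
theorem eq_one_of_unipotent_of_isCompact {d : ℕ} {U : Matrix (Fin d) (Fin d) ℝ} {m : ℕ}
    (hU : (U - 1) ^ m = 0) {S : Set (Matrix (Fin d) (Fin d) ℝ)} (hS : IsCompact S)
    (hUS : ∀ k : ℕ, U ^ k ∈ S) : U = 1 := by
  obtain ⟨C, hC⟩ := Bornology.IsBounded.exists_norm_le (IsCompact.isBounded hS)
  exact eq_one_of_unipotent_of_bounded hU fun k => hC _ (hUS k)

end Matrix

/-! ### The adjoint representation -/

namespace ClosedSubgroup

variable {d : ℕ} (G : ClosedSubgroup (GL (Fin d) ℝ))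

instance : IsTopologicalAddGroup G.lieAlgebra :=
  inferInstanceAs (IsTopologicalAddGroup G.lieAlgebra.toSubmodule)

instance : ContinuousSMul ℝ G.lieAlgebra :=
  inferInstanceAs (ContinuousSMul ℝ G.lieAlgebra.toSubmodule)

instance : FiniteDimensional ℝ G.lieAlgebra :=
  inferInstanceAs (FiniteDimensional ℝ G.lieAlgebra.toSubmodule)

theorem continuous_exp : Continuous G.exp :=
  (continuous_expGL.comp continuous_subtype_val).subtype_mk _

/-- The adjoint representation. -/
noncomputable def AdHom : G.Pt →* Module.End ℝ G.lieAlgebra where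
  toFun g :=
    { toFun := G.Ad g
      map_add' := fun X Y => Subtype.ext (by simp [Ad, mul_add, add_mul])
      map_smul' := fun c X => Subtype.ext (by simp [Ad]) }
  map_one' := LinearMap.ext fun X => Subtype.ext (by simp [Ad])
  map_mul' g h := LinearMap.ext fun X => Subtype.ext (by simp [Ad, mul_assoc])

theorem AdHom_coe (g : G.Pt) (X : G.lieAlgebra) :
    (G.AdHom g X : Matrix (Fin d) (Fin d) ℝ) =
      ((g : GL (Fin d) ℝ) : Matrix (Fin d) (Fin d) ℝ) * X *
        (((g : GL (Fin d) ℝ)⁻¹ : GL (Fin d) ℝ) : Matrix (Fin d) (Fin d) ℝ) := rfl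

theorem exp_AdHom (g : G.Pt) (X : G.lieAlgebra) : G.exp (G.AdHom g X) = g * G.exp X * g⁻¹ :=
  Subtype.ext (expGL_conj _ _)

theorem AdHom_lie (g : G.Pt) (X Y : G.lieAlgebra) :
    G.AdHom g ⁅X, Y⁆ = ⁅G.AdHom g X, G.AdHom g Y⁆ :=
  Subtype.ext (by simp [AdHom_coe, Ring.lie_def, mul_sub, sub_mul, mul_assoc])

theorem AdHom_inv_apply (g : G.Pt) (X : G.lieAlgebra) : G.AdHom g⁻¹ (G.AdHom g X) = X := by
  rw [← Module.End.mul_apply, ← map_mul]; simp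

theorem AdHom_apply_inv (g : G.Pt) (X : G.lieAlgebra) : G.AdHom g (G.AdHom g⁻¹ X) = X := by
  rw [← Module.End.mul_apply, ← map_mul]; simp

theorem continuous_AdHom (X : G.lieAlgebra) : Continuous fun g : G.Pt => G.AdHom g X := by
  refine Continuous.subtype_mk ?_ _
  exact ((Units.continuous_val.comp continuous_subtype_val).mul continuous_const).mul
    (Units.continuous_val.comp (continuous_inv.comp continuous_subtype_val))

theorem AdHom_exp_of_lie {X Y : G.lieAlgebra} {c : ℝ} (h : ⁅X, Y⁆ = c • Y) :
    G.AdHom (G.exp X) Y = Real.exp c • Y :=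
  Subtype.ext <| exp_mul_mul_exp_neg_of_lie_eq_smul <| by
    simpa [Ring.lie_def] using congrArg (fun Z : G.lieAlgebra => (Z : Matrix (Fin d) (Fin d) ℝ)) h

/-- `Ad g X` and `X` generate the same one-parameter group, and its derivative at `0` determines the
generator. -/
theorem AdHom_eq_of_commute {g : G.Pt} {X : G.lieAlgebra}
    (h : ∀ t : ℝ, g * G.exp (t • X) = G.exp (t • X) * g) : G.AdHom g X = X := by
  refine Subtype.ext (eq_of_expGL_smul_eq fun t => ?_)
  have h1 : G.exp (t • G.AdHom g X) = G.exp (t • X) := by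
    rw [← map_smul, exp_AdHom, h t]; group
  exact congrArg Subtype.val h1

variable {G} in
/-- For a Cartan decomposition, `ad X` with `X ∈ 𝔭` has a basis of eigenvectors. -/
theorem IsCartanDecomposition.exists_basis {k p : Submodule ℝ G.lieAlgebra}
    (h : G.IsCartanDecomposition k p) {X : G.lieAlgebra} (hX : X ∈ p) :
    ∃ (b : Module.Basis (Fin (Module.finrank ℝ G.lieAlgebra)) ℝ G.lieAlgebra)
      (c : Fin (Module.finrank ℝ G.lieAlgebra) → ℝ), ∀ i, ⁅X, b i⁆ = c i • b i := by
  let πk := k.projection p h.isCompl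
  let πp := p.projection k h.isCompl.symm
  let B := killingForm ℝ G.lieAlgebra
  -- The Killing form with its sign reversed on `𝔨` is positive definite. `ad X` is skew for the
  -- Killing form and exchanges `𝔨` and `𝔭`, so the sign change makes it symmetric for `Q`.
  let Q : G.lieAlgebra →ₗ[ℝ] G.lieAlgebra →ₗ[ℝ] ℝ := B.compl₁₂ πp πp - B.compl₁₂ πk πk
  have hQ : ∀ Y Z, Q Y Z = B (πp Y) (πp Z) - B (πk Y) (πk Z) := fun Y Z => rfl
  have hB : ∀ Y Z, B Y Z = B Z Y := LieModule.traceForm_comm ℝ _ _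
  have hBX : ∀ Y Z, B ⁅X, Y⁆ Z = -B Y ⁅X, Z⁆ := fun Y Z => by
    rw [← lie_skew, map_neg, LinearMap.neg_apply]
    exact congrArg Neg.neg (LieModule.traceForm_apply_lie_apply ℝ _ _ Y X Z)
  have hk : ∀ Y, πk Y ∈ k := Submodule.projection_apply_mem h.isCompl
  have hp : ∀ Y, πp Y ∈ p := Submodule.projection_apply_mem h.isCompl.symm
  have hadd : ∀ Y, πk Y + πp Y = Y := Submodule.projection_add_projection_eq_self h.isCompl
  have hlk : ∀ Y ∈ k, ⁅X, Y⁆ ∈ p := fun Y hY => by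
    rw [← lie_skew]; exact p.neg_mem (h.lie_k_p Y hY X hX)
  have hlp : ∀ Y ∈ p, ⁅X, Y⁆ ∈ k := fun Y hY => h.lie_p_p X hX Y hY
  have hXk : ∀ Y, πk ⁅X, Y⁆ = ⁅X, πp Y⁆ := fun Y => by
    conv_lhs => rw [← hadd Y, lie_add, map_add]
    rw [(Submodule.projection_apply_eq_zero_iff h.isCompl).2 (hlk _ (hk Y)), zero_add]
    exact Submodule.projection_apply_of_mem_left h.isCompl (hlp _ (hp Y))
  have hXp : ∀ Y, πp ⁅X, Y⁆ = ⁅X, πk Y⁆ := fun Y => by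
    conv_lhs => rw [← hadd Y, lie_add, map_add]
    rw [(Submodule.projection_apply_eq_zero_iff h.isCompl.symm).2 (hlp _ (hp Y)), add_zero]
    exact Submodule.projection_apply_of_mem_left h.isCompl.symm (hlk _ (hk Y))
  refine LinearMap.exists_basis_eigenvectors Q (fun Y Z => ?_) (fun Y hY => ?_)
    (LieAlgebra.ad ℝ G.lieAlgebra X) fun Y Z => ?_
  · rw [hQ, hQ, hB, hB (πk Y)]
  · rw [hQ, sub_pos]
    have hk' : B (πk Y) (πk Y) ≤ 0 := by
      by_cases h0 : πk Y = 0
      · simp [h0]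
      · exact (h.neg_k _ (hk Y) h0).le
    by_cases h0 : πp Y = 0
    · have h1 : πk Y ≠ 0 := fun h1 => hY (by rw [← hadd Y, h0, h1, add_zero])
      rw [h0, map_zero]
      exact h.neg_k _ (hk Y) h1
    · exact hk'.trans_lt (h.pos_p _ (hp Y) h0)
  · simp only [LieAlgebra.ad_apply, hQ, hXk, hXp, hBX]
    ring

end ClosedSubgroup

/-! ### Exponentials with equal limits at both ends -/

/-- The limit at `-∞` forces `l = 0`; multiplying the limit at `+∞` by the decaying `exp(-tc)`
forces `r = 0`. -/
theorem Real.eq_of_tendsto_exp_mul_of_pos {c r l : ℝ} (hc : 0 < c)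
    (h1 : Tendsto (fun t : ℝ => Real.exp (t * c) * r) atTop (𝓝 l))
    (h2 : Tendsto (fun t : ℝ => Real.exp (t * c) * r) atBot (𝓝 l)) : r = l := by
  have hl : l = 0 := by
    refine tendsto_nhds_unique h2 ?_
    simpa using (Real.tendsto_exp_atBot.comp (tendsto_id.atBot_mul_const hc)).mul_const r
  have hr : r = 0 := by
    have h3 : Tendsto (fun t : ℝ => Real.exp (-(t * c))) atTop (𝓝 0) :=
      Real.tendsto_exp_neg_atTop_nhds_zero.comp (tendsto_id.atTop_mul_const hc)
    have h4 := h3.mul h1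
    rw [zero_mul] at h4
    refine tendsto_nhds_unique tendsto_const_nhds (h4.congr fun t => ?_)
    rw [← mul_assoc, ← Real.exp_add]
    simp
  rw [hl, hr]

theorem Real.eq_of_tendsto_exp_mul {c r l : ℝ}
    (h1 : Tendsto (fun t : ℝ => Real.exp (t * c) * r) atTop (𝓝 l))
    (h2 : Tendsto (fun t : ℝ => Real.exp (t * c) * r) atBot (𝓝 l)) : r = l := by
  rcases lt_trichotomy c 0 with hc | rfl | hc
  · refine Real.eq_of_tendsto_exp_mul_of_pos (neg_pos.2 hc)
      ((h2.comp tendsto_neg_atTop_atBot).congr fun t => ?_)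
      ((h1.comp tendsto_neg_atBot_atTop).congr fun t => ?_) <;> simp
  · simp only [mul_zero, Real.exp_zero, one_mul] at h1
    exact tendsto_nhds_unique tendsto_const_nhds h1
  · exact Real.eq_of_tendsto_exp_mul_of_pos hc h1 h2

namespace ClosedSubgroup.CartanData

variable {d : ℕ} {G : ClosedSubgroup (GL (Fin d) ℝ)} (D : G.CartanData)

theorem a_le_p : D.a ≤ D.p := D.maximal_a.prop.1

theorem exp_mem_A (X : D.a) : G.exp X ∈ D.A := ⟨X, X.2, rfl⟩

theorem exp_a_add (X Y : D.a) : G.exp (X + Y : D.a) = G.exp X * G.exp Y :=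
  G.exp_add (D.lie_a X.2 Y.2)

theorem exp_a_neg (X : D.a) : G.exp (-X : D.a) = (G.exp X)⁻¹ := G.exp_neg _

theorem exp_a_smul_nat (X : D.a) (k : ℕ) : G.exp ((k : ℝ) • X : D.a) = G.exp X ^ k := by
  induction k with
  | zero => simpa using G.exp_zero
  | succ k ih => rw [Nat.cast_succ, add_smul, one_smul, exp_a_add, ih, pow_succ]

theorem commute_of_mem_A {x y : G.Pt} (hx : x ∈ D.A) (hy : y ∈ D.A) : x * y = y * x := by
  obtain ⟨X, hX, rfl⟩ := hx
  obtain ⟨Y, hY, rfl⟩ := hy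
  rw [← G.exp_add (D.lie_a hX hY), ← G.exp_add (D.lie_a hY hX), add_comm]

/-! ### Normalization of `N` -/

theorem AdHom_eq_of_mem_M {m : G.Pt} (hm : m ∈ D.M) (X : D.a) : G.AdHom m X = X :=
  G.AdHom_eq_of_commute fun t => (D.commute_of_mem_M hm (D.exp_mem_A (t • X))).symm

theorem AdHom_eq_of_mem_A {x : G.Pt} (hx : x ∈ D.A) (X : D.a) : G.AdHom x X = X :=
  G.AdHom_eq_of_commute fun t => D.commute_of_mem_A hx (D.exp_mem_A (t • X))

theorem AdHom_eq_of_mem_AM {x : G.Pt} (hx : x ∈ D.AM) (X : D.a) : G.AdHom x X = X := by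
  -- Fixing `X` is a subgroup condition, so it suffices to check it on `A` and on `M`.
  have h : D.AM ≤ (MulAction.stabilizer (Module.End ℝ G.lieAlgebra)ˣ (X : G.lieAlgebra)).comap
      G.AdHom.toHomUnits :=
    sup_le (fun x hx => D.AdHom_eq_of_mem_A hx X) fun x hx => D.AdHom_eq_of_mem_M hx X
  exact h hx

/-- As `Ad x` fixes `𝔞` pointwise, it commutes with `ad 𝔞` and preserves each root space. -/
theorem AdHom_mem_n {x : G.Pt} (hx : x ∈ D.AM) {Y : G.lieAlgebra} (hY : Y ∈ D.n) :
    G.AdHom x Y ∈ D.n := by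
  have h : D.n ≤ D.n.comap (G.AdHom x) := by
    refine iSup₂_le fun α hα v hv => ?_
    refine Submodule.mem_iSup_of_mem α (Submodule.mem_iSup_of_mem hα fun u => ?_)
    conv_lhs => rw [← D.AdHom_eq_of_mem_AM hx u]
    rw [← G.AdHom_lie, hv u, map_smul]
  exact h hY

theorem conj_mem_N {x : G.Pt} (hx : x ∈ D.AM) {u : G.Pt} (hu : u ∈ D.N) :
    x * u * x⁻¹ ∈ D.N := by
  have h : D.N ≤ D.N.comap (MulAut.conj x).toMonoidHom := by
    refine (Subgroup.closure_le _).2 ?_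
    rintro _ ⟨Y, hY, rfl⟩
    exact Subgroup.subset_closure ⟨_, D.AdHom_mem_n hx hY, (G.exp_AdHom x Y).symm⟩
  exact h hu

theorem inv_conj_mem_N {x : G.Pt} (hx : x ∈ D.AM) {u : G.Pt} (hu : u ∈ D.N) :
    x⁻¹ * u * x ∈ D.N := by
  simpa using D.conj_mem_N (D.AM.inv_mem hx) hu

/-! ### Contraction of `N` by the chamber -/

/-- `exp (-tH)` contracts `N` as `t → ∞` if all positive roots are positive at `H`. -/
theorem tendsto_conj_of_mem_N {H : D.a} (hH : ∀ α ∈ D.posRoots, 0 < α H) {u : G.Pt}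
    (hu : u ∈ D.N) :
    Tendsto (fun t : ℝ => (G.exp (t • H : D.a))⁻¹ * u * G.exp (t • H : D.a)) atTop (𝓝 1) := by
  have hn : ∀ Y ∈ D.n,
      Tendsto (fun t : ℝ => G.AdHom (G.exp (t • H : D.a))⁻¹ Y) atTop (𝓝 0) := by
    intro Y hY
    -- The contracted vectors form a subspace, so only root vectors need checking; on `𝔤_α` the
    -- action is the scalar `exp(-t α(H))`.
    let S : Submodule ℝ G.lieAlgebra :=
      { carrier := {Y | Tendsto (fun t : ℝ => G.AdHom (G.exp (t • H : D.a))⁻¹ Y) atTop (𝓝 0)}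
        zero_mem' := by simp
        add_mem' := fun {Y Z} hY hZ => by
          have := Tendsto.add hY hZ
          simpa using this
        smul_mem' := fun c Y hY => by
          have := Tendsto.const_smul hY c
          simpa using this }
    have h : D.n ≤ S := by
      refine iSup₂_le fun α hα v hv => ?_
      change Tendsto _ _ _
      have e : ∀ t : ℝ, G.AdHom (G.exp (t • H : D.a))⁻¹ v = Real.exp (-(t * α H)) • v := by
        intro t
        rw [← exp_a_neg]
        refine G.AdHom_exp_of_lie ?_
        rw [hv]
        simp
      simp only [e]
      have h1 : Tendsto (fun t : ℝ => Real.exp (-(t * α H))) atTop (𝓝 0) :=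
        Real.tendsto_exp_neg_atTop_nhds_zero.comp (tendsto_id.atTop_mul_const (hH α hα))
      simpa using h1.smul_const v
    exact h hY
  -- Convergence to `1` survives products and inverses, so generators suffice and `N = exp 𝔫` is not
  -- needed.
  induction hu using Subgroup.closure_induction with
  | mem x hx =>
    obtain ⟨Y, hY, rfl⟩ := hx
    have h1 := (G.continuous_exp.tendsto 0).comp (hn Y hY)
    rw [G.exp_zero] at h1
    refine h1.congr fun t => ?_
    simp only [Function.comp_apply]
    rw [G.exp_AdHom, inv_inv]
  | one => simp
  | mul x y _ _ hx hy =>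
    have := hx.mul hy
    rw [mul_one] at this
    refine this.congr fun t => ?_
    group
  | inv x _ hx =>
    have := hx.inv
    rw [inv_one] at this
    refine this.congr fun t => ?_
    group

/-- The chamber contains a regular element. -/
theorem exists_mem_chamber : ∃ H ∈ D.chamber, H ∈ G.regularSet D.a := by
  obtain ⟨X, hX, hC⟩ := D.isChamber
  exact ⟨X, hC ▸ mem_connectedComponentIn hX, hX⟩

/-! ### Triviality of `K ∩ AN` -/

theorem _root_.ClosedSubgroup.continuous_trace_AdHom (G : ClosedSubgroup (GL (Fin d) ℝ)) :
    Continuous fun g : G.Pt => LinearMap.trace ℝ _ (G.AdHom g) := by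
  let b := Module.finBasis ℝ G.lieAlgebra
  simp only [LinearMap.trace_eq_matrix_trace ℝ b, Matrix.trace, Matrix.diag_apply,
    LinearMap.toMatrix_apply]
  exact continuous_finsetSum _ fun i _ =>
    (LinearMap.continuous_of_finiteDimensional (b.coord i)).comp (G.continuous_AdHom (b i))

/-- Conjugating `x u` by `exp(-tH)` keeps the trace and fixes `x`, while it contracts `u` to `1`. -/
theorem trace_AdHom_mul_of_mem_N {x u : G.Pt} (hx : x ∈ D.A) (hu : u ∈ D.N) :
    LinearMap.trace ℝ _ (G.AdHom (x * u)) = LinearMap.trace ℝ _ (G.AdHom x) := by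
  obtain ⟨H, hH, -⟩ := D.exists_mem_chamber
  have h1 := (D.tendsto_conj_of_mem_N (fun α hα => hα.2 H hH) hu).const_mul x
  rw [mul_one] at h1
  have h2 := (G.continuous_trace_AdHom.tendsto x).comp h1
  refine tendsto_nhds_unique tendsto_const_nhds (h2.congr fun t => ?_)
  have e : x * ((G.exp (t • H : D.a))⁻¹ * u * G.exp (t • H : D.a)) =
      (G.exp (t • H : D.a))⁻¹ * ((x * u) * G.exp (t • H : D.a)) := by
    rw [← mul_assoc, ← mul_assoc, D.commute_of_mem_A hx (D.A.inv_mem (D.exp_mem_A _))]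
    group
  simp only [Function.comp_apply]
  rw [e, map_mul, LinearMap.trace_mul_comm, ← map_mul]
  simp

theorem exists_mul_pow_eq {x u : G.Pt} (hx : x ∈ D.AM) (hu : u ∈ D.N) (k : ℕ) :
    ∃ v ∈ D.N, (x * u) ^ k = x ^ k * v := by
  induction k with
  | zero => exact ⟨1, D.N.one_mem, by simp⟩
  | succ k ih =>
    obtain ⟨v, hv, e⟩ := ih
    refine ⟨x⁻¹ * v * x * u, D.N.mul_mem (D.inv_conj_mem_N hx hv) hu, ?_⟩
    rw [pow_succ, e, pow_succ]
    group

/-- The powers of `exp(X) u` stay in the compact group `K`, so the traces `∑ exp(k c_i)` of their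
adjoint actions are bounded in `k`. -/
theorem eigenvalue_nonpos_of_exp_mul_mem_K {X : D.a} {u : G.Pt} (hu : u ∈ D.N)
    (h : G.exp X * u ∈ D.K) {ι : Type*} [Fintype ι] (b : Module.Basis ι ℝ G.lieAlgebra)
    (c : ι → ℝ) (hb : ∀ i, ⁅(X : G.lieAlgebra), b i⁆ = c i • b i) (i : ι) : c i ≤ 0 := by
  classical
  have htr : ∀ k : ℕ, LinearMap.trace ℝ _ (G.AdHom ((G.exp X * u) ^ k)) =
      ∑ i, Real.exp (k * c i) := by
    intro k
    obtain ⟨v, hv, e⟩ := D.exists_mul_pow_eq (Subgroup.mem_sup_left (D.exp_mem_A X)) hu k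
    rw [e, D.trace_AdHom_mul_of_mem_N (D.A.pow_mem (D.exp_mem_A X) k) hv,
      ← exp_a_smul_nat, LinearMap.trace_eq_matrix_trace ℝ b, Matrix.trace]
    refine Finset.sum_congr rfl fun i _ => ?_
    have : ⁅(((k : ℝ) • X : D.a) : G.lieAlgebra), b i⁆ = (k * c i) • b i := by
      simp [hb, smul_smul]
    rw [Matrix.diag_apply, LinearMap.toMatrix_apply, G.AdHom_exp_of_lie this]
    simp
  obtain ⟨C, hC⟩ := (D.maximal_K.prop.image G.continuous_trace_AdHom).bddAbove
  by_contra! hpos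
  have hle : ∀ k : ℕ, Real.exp (k * c i) ≤ C := fun k => by
    refine le_trans ?_ (hC ⟨_, D.K.pow_mem h k, htr k⟩)
    exact Finset.single_le_sum (f := fun i => Real.exp (k * c i))
      (fun j _ => (Real.exp_pos _).le) (Finset.mem_univ i)
  have ht : Tendsto (fun k : ℕ => Real.exp (k * c i)) atTop atTop :=
    Real.tendsto_exp_atTop.comp (tendsto_natCast_atTop_atTop.atTop_mul_const hpos)
  obtain ⟨k, hk⟩ := (ht.eventually (eventually_gt_atTop C)).exists
  exact (hle k).not_gt hk

theorem eq_zero_of_exp_mul_mem_K (hss : LieAlgebra.IsSemisimple ℝ G.lieAlgebra) {X : D.a}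
    {u : G.Pt} (hu : u ∈ D.N) (h : G.exp X * u ∈ D.K) : X = 0 := by
  obtain ⟨b, c, hb⟩ := D.cartan.exists_basis (D.a_le_p X.2)
  have h1 := D.eigenvalue_nonpos_of_exp_mul_mem_K hu h b c hb
  have hX : G.exp X ∈ D.AM := Subgroup.mem_sup_left (D.exp_mem_A X)
  -- The inverse of `exp(X) u`, rewritten with its `A`-factor first; it yields the opposite
  -- inequalities for the eigenvalues.
  have h' : G.exp (-X : D.a) * (G.exp X * u⁻¹ * (G.exp X)⁻¹) ∈ D.K := by
    have := D.K.inv_mem h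
    rw [exp_a_neg]
    convert this using 1
    group
  have h2 := D.eigenvalue_nonpos_of_exp_mul_mem_K (D.conj_mem_N hX (D.N.inv_mem hu)) h' b
    (fun i => -c i) fun i => by simp [hb]
  have hc : ∀ i, c i = 0 := fun i => le_antisymm (h1 i) (by simpa using h2 i)
  have had : LieAlgebra.ad ℝ G.lieAlgebra X = 0 := b.ext fun i => by simp [hb, hc]
  have hz : (X : G.lieAlgebra) ∈ LieAlgebra.center ℝ G.lieAlgebra := by
    rwa [← LieAlgebra.self_module_ker_eq_center, ← LieAlgebra.ad_ker_eq_self_module_ker,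
      LieHom.mem_ker]
  rw [LieAlgebra.center_eq_bot, LieSubmodule.mem_bot] at hz
  exact Subtype.ext hz

/-- Contraction to `1` makes `u` unipotent, and compactness of `K` bounds its powers. -/
theorem eq_one_of_mem_N_of_mem_K {u : G.Pt} (hu : u ∈ D.N) (h : u ∈ D.K) : u = 1 := by
  obtain ⟨H, hH, -⟩ := D.exists_mem_chamber
  have h1 := (continuous_subtype_val.tendsto (1 : G.Pt)).comp
    (D.tendsto_conj_of_mem_N (fun α hα => hα.2 H hH) hu)
  have h2 := Matrix.sub_one_pow_eq_zero_of_tendsto_conj (u := (u : GL (Fin d) ℝ))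
    (a := fun t => ((G.exp (t • H : D.a))⁻¹ : G.Pt)) (h1.congr fun t => by simp)
  refine Subtype.ext (Units.ext ?_)
  refine Matrix.eq_one_of_unipotent_of_isCompact h2
    (D.maximal_K.prop.image (Units.continuous_val.comp continuous_subtype_val)) fun k => ?_
  exact ⟨u ^ k, D.K.pow_mem h k, by simp⟩

theorem eq_one_of_exp_mul_mem_K (hss : LieAlgebra.IsSemisimple ℝ G.lieAlgebra) {X : D.a}
    {u : G.Pt} (hu : u ∈ D.N) (h : G.exp X * u ∈ D.K) : X = 0 ∧ u = 1 := by
  obtain rfl := D.eq_zero_of_exp_mul_mem_K hss hu h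
  refine ⟨rfl, D.eq_one_of_mem_N_of_mem_K hu ?_⟩
  rw [show G.exp ((0 : D.a) : G.lieAlgebra) = 1 from G.exp_zero, one_mul] at h
  exact h

/-! ### Triviality of `N ∩ MA(k_ι N k_ι⁻¹)` -/

/-- In an eigenbasis of `ad H` each coordinate of the orbit of `w` is a real exponential with equal
limits at both ends, hence constant. -/
theorem eq_of_tendsto_AdHom_exp {H : D.a} {w v : G.lieAlgebra}
    (h1 : Tendsto (fun t : ℝ => G.AdHom (G.exp (t • H : D.a)) w) atTop (𝓝 v))
    (h2 : Tendsto (fun t : ℝ => G.AdHom (G.exp (t • H : D.a)) w) atBot (𝓝 v)) : w = v := by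
  obtain ⟨b, c, hb⟩ := D.cartan.exists_basis (D.a_le_p H.2)
  refine b.ext_elem fun i => ?_
  have hcoord : ∀ t : ℝ, b.coord i (G.AdHom (G.exp (t • H : D.a)) w) =
      Real.exp (t * c i) * b.repr w i := by
    intro t
    have e : b.coord i ∘ₗ G.AdHom (G.exp (t • H : D.a)) = Real.exp (t * c i) • b.coord i := by
      refine b.ext fun j => ?_
      have : ⁅((t • H : D.a) : G.lieAlgebra), b j⁆ = (t * c j) • b j := by
        simp [hb, smul_smul]
      rw [LinearMap.comp_apply, G.AdHom_exp_of_lie this]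
      by_cases hij : j = i
      · simp [hij]
      · simp [hij]
    exact congrArg (fun f => f w) e
  have hcont : Continuous (b.coord i) := LinearMap.continuous_of_finiteDimensional _
  have h1' := (hcont.tendsto v).comp h1
  have h2' := (hcont.tendsto v).comp h2
  simp only [Function.comp_def, hcoord] at h1' h2'
  exact Real.eq_of_tendsto_exp_mul h1' h2'

theorem AdHom_kι_mem_a {X : G.lieAlgebra} (hX : X ∈ D.a) : G.AdHom D.kι X ∈ D.a := by
  have : G.Ad D.kι X ∈ (D.a : Set G.lieAlgebra) := D.Ad_kι_a ▸ ⟨X, hX, rfl⟩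
  exact this

theorem AdHom_kι_inv_mem_a {X : G.lieAlgebra} (hX : X ∈ D.a) : G.AdHom D.kι⁻¹ X ∈ D.a := by
  have : X ∈ G.Ad D.kι '' (D.a : Set G.lieAlgebra) := D.Ad_kι_a.symm ▸ hX
  obtain ⟨Y, hY, rfl⟩ := this
  exact (G.AdHom_inv_apply D.kι Y).symm ▸ hY

/-- The normalizer element `k_ι` permutes the root hyperplanes. -/
theorem ne_zero_of_AdHom_kι_eq_neg {H H' : D.a} (hH : H ∈ G.regularSet D.a)
    (h : G.AdHom D.kι H' = -(H : G.lieAlgebra)) {α : Module.Dual ℝ D.a} (hα : α ∈ G.roots D.a) :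
    α H' ≠ 0 := by
  intro h0
  let f : D.a →ₗ[ℝ] D.a :=
    (G.AdHom D.kι⁻¹).restrict fun X hX => D.AdHom_kι_inv_mem_a hX
  have hfval : ∀ X : D.a, (f X : G.lieAlgebra) = G.AdHom D.kι⁻¹ X := fun X => rfl
  have hfH : f H = -H' := Subtype.ext <| by
    rw [hfval, ← neg_neg (H : G.lieAlgebra), ← h, map_neg, G.AdHom_inv_apply]; rfl
  -- The transported form `α ∘ f` is again a root, because `Ad k_ι` carries `𝔤_α` into its root
  -- space; it would vanish at the regular element `H`.
  refine hH (α ∘ₗ f) ⟨fun hz => hα.1 ?_, fun hz => hα.2 ?_⟩ ?_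
  · refine LinearMap.ext fun X => ?_
    have e : f ⟨G.AdHom D.kι X, D.AdHom_kι_mem_a X.2⟩ = X :=
      Subtype.ext (G.AdHom_inv_apply D.kι X)
    rw [← e]
    exact congrArg (fun β : Module.Dual ℝ D.a => β ⟨G.AdHom D.kι X, D.AdHom_kι_mem_a X.2⟩) hz
  · refine (Submodule.eq_bot_iff _).2 fun v hv => ?_
    have hmem : G.AdHom D.kι v ∈ G.rootSpace D.a (α ∘ₗ f) := fun X => by
      have := hv (f X)
      rw [LinearMap.comp_apply, ← map_smul, ← this, G.AdHom_lie, hfval, G.AdHom_apply_inv]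
    rw [hz, Submodule.mem_bot] at hmem
    rw [← G.AdHom_inv_apply D.kι v, hmem, map_zero]
  · rw [LinearMap.comp_apply, hfH, map_neg, h0, neg_zero]

theorem nonneg_of_mem_closure_chamber {H : D.a} (hH : H ∈ closure D.chamber)
    {α : Module.Dual ℝ D.a} (hα : α ∈ D.posRoots) : 0 ≤ α H := by
  have hc : IsClosed {X : D.a | 0 ≤ α X} :=
    isClosed_le continuous_const (LinearMap.continuous_of_finiteDimensional α)
  exact closure_minimal (fun X hX => (hα.2 X hX).le) hc hH

/-- `N` meets `MA(k_ι N k_ι⁻¹)` trivially. -/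
theorem eq_one_of_eq_mul_conj_kι {u x v : G.Pt} (hu : u ∈ D.N) (hx : x ∈ D.AM) (hv : v ∈ D.N)
    (h : u = x * (D.kι * v * D.kι⁻¹)) : u = 1 := by
  obtain ⟨H, hHC, hHr⟩ := D.exists_mem_chamber
  obtain ⟨_, ⟨H', hH'C, rfl⟩, hH'⟩ : -(H : G.lieAlgebra) ∈
      G.Ad D.kι '' (Subtype.val '' closure D.chamber) := by
    rw [D.Ad_kι]
    exact Set.neg_mem_neg.2 ⟨H, subset_closure hHC, rfl⟩
  -- `H'` is only known to lie in the closed chamber; being off the root hyperplanes turns `≥` into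
  -- `>`.
  have hpos : ∀ α ∈ D.posRoots, 0 < α H' := fun α hα =>
    lt_of_le_of_ne (D.nonneg_of_mem_closure_chamber hH'C hα)
      (D.ne_zero_of_AdHom_kι_eq_neg hHr hH' hα.1).symm
  have hexp : ∀ t : ℝ, G.exp (t • H : D.a) = D.kι * (G.exp (t • H' : D.a))⁻¹ * D.kι⁻¹ := by
    intro t
    rw [← exp_a_neg, ← G.exp_AdHom]
    congr 1
    have e : G.AdHom D.kι H' = -(H : G.lieAlgebra) := hH'
    push_cast
    rw [map_neg, map_smul, e]
    simp
  have hcu := D.tendsto_conj_of_mem_N (fun α hα => hα.2 H hHC) hu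
  -- The backward conjugation, which need not converge on `N`, does so here: through `k_ι` it
  -- becomes the contraction of `v` by `exp(-tH')`, while `x` commutes with the flow.
  have hcv : Tendsto (fun t : ℝ => G.exp (t • H : D.a) * u * (G.exp (t • H : D.a))⁻¹) atTop
      (𝓝 x) := by
    have h1 := (((D.tendsto_conj_of_mem_N hpos hv).const_mul D.kι).mul_const D.kι⁻¹).const_mul x
    rw [mul_one, mul_inv_cancel, mul_one] at h1
    refine h1.congr fun t => ?_
    have hxc : x * G.exp (t • H : D.a) = G.exp (t • H : D.a) * x := by
      have := G.exp_AdHom x (t • H : D.a)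
      rw [D.AdHom_eq_of_mem_AM hx] at this
      nth_rewrite 2 [this]
      group
    rw [h, ← mul_assoc (G.exp _), ← hxc, hexp]
    group
  -- Both limits `x` and `1` fix `H`, so the orbit of `Ad u H` under `Ad exp(tH)` tends to `H` at
  -- both ends.
  have hAd : G.AdHom u H = H := by
    refine D.eq_of_tendsto_AdHom_exp (H := H) ?_ ?_
    · have h1 := ((G.continuous_AdHom (H : G.lieAlgebra)).tendsto x).comp hcv
      rw [D.AdHom_eq_of_mem_AM hx] at h1
      refine h1.congr fun t => ?_
      simp only [Function.comp_apply, map_mul, Module.End.mul_apply]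
      rw [D.AdHom_eq_of_mem_A (D.A.inv_mem (D.exp_mem_A _))]
    · have h1 := ((G.continuous_AdHom (H : G.lieAlgebra)).tendsto 1).comp
        (hcu.comp tendsto_neg_atBot_atTop)
      rw [map_one, Module.End.one_apply] at h1
      refine h1.congr fun t => ?_
      simp only [Function.comp_apply, map_mul, Module.End.mul_apply]
      rw [D.AdHom_eq_of_mem_A (D.exp_mem_A _), neg_smul, exp_a_neg, inv_inv]
  -- Now `u` commutes with the flow, so the conjugates that tend to `1` are constantly `u`.
  refine tendsto_nhds_unique tendsto_const_nhds (hcu.congr fun t => ?_)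
  have h1 := G.exp_AdHom u (t • H : D.a)
  rw [Submodule.coe_smul, map_smul, hAd] at h1
  rw [Submodule.coe_smul, mul_assoc, inv_mul_eq_iff_eq_mul]
  nth_rewrite 2 [h1]
  group

end ClosedSubgroup.CartanData

namespace ClosedSubgroup.CartanData

variable {d : ℕ} {G : ClosedSubgroup (GL (Fin d) ℝ)} (D : G.CartanData)

/-! ### The subgroups `AM` and `MAN`, and `log x_A` -/

theorem exists_eq_exp_mul {x : G.Pt} (hx : x ∈ D.AM) :
    ∃ X : D.a, ∃ m ∈ D.M, x = G.exp X * m := by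
  have h : D.AM ≤
      { carrier := {x | ∃ X : D.a, ∃ m ∈ D.M, x = G.exp X * m}
        one_mem' := ⟨0, 1, D.M.one_mem, by simpa using G.exp_zero.symm⟩
        mul_mem' := by
          rintro _ _ ⟨X, m, hm, rfl⟩ ⟨Y, n, hn, rfl⟩
          refine ⟨X + Y, m * n, D.M.mul_mem hm hn, ?_⟩
          rw [exp_a_add, mul_assoc (G.exp X), ← mul_assoc m,
            ← D.commute_of_mem_M hm (D.exp_mem_A Y)]
          group
        inv_mem' := by
          rintro _ ⟨X, m, hm, rfl⟩
          refine ⟨-X, m⁻¹, D.M.inv_mem hm, ?_⟩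
          rw [D.commute_of_mem_M hm (D.exp_mem_A X), _root_.mul_inv_rev, exp_a_neg] } := by
    refine sup_le ?_ fun m hm => ⟨0, m, hm, ?_⟩
    · rintro _ ⟨X, hX, rfl⟩
      exact ⟨⟨X, hX⟩, 1, D.M.one_mem, (mul_one _).symm⟩
    · rw [show G.exp ((0 : D.a) : G.lieAlgebra) = 1 from G.exp_zero, one_mul]
  exact h hx

/-- Uniqueness in the Iwasawa decomposition: the quotient of the two `AN`-parts lies in `K ∩ AN`. -/
theorem exp_mul_inj (hss : LieAlgebra.IsSemisimple ℝ G.lieAlgebra) {X Y : D.a} {k k' u u' : G.Pt}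
    (hk : k ∈ D.K) (hk' : k' ∈ D.K) (hu : u ∈ D.N) (hu' : u' ∈ D.N)
    (h : k * G.exp X * u = k' * G.exp Y * u') : X = Y ∧ u = u' := by
  have hY : G.exp Y ∈ D.AM := Subgroup.mem_sup_left (D.exp_mem_A Y)
  have hmem : G.exp (X - Y : D.a) * (G.exp Y * (u * u'⁻¹) * (G.exp Y)⁻¹) ∈ D.K := by
    have e : G.exp (X - Y : D.a) * (G.exp Y * (u * u'⁻¹) * (G.exp Y)⁻¹) = k⁻¹ * k' := by
      rw [sub_eq_add_neg, exp_a_add, exp_a_neg, eq_inv_mul_iff_mul_eq]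
      have : k * G.exp X * u * u'⁻¹ * (G.exp Y)⁻¹ = k' := by rw [h]; group
      rw [← this]
      group
    rw [e]
    exact D.K.mul_mem (D.K.inv_mem hk) hk'
  obtain ⟨h1, h2⟩ := D.eq_one_of_exp_mul_mem_K hss
    (D.conj_mem_N hY (D.N.mul_mem hu (D.N.inv_mem hu'))) hmem
  refine ⟨sub_eq_zero.1 h1, ?_⟩
  rw [conj_eq_one_iff] at h2
  exact mul_inv_eq_one.1 h2

/-- Shows that the choice in `logA` is harmless: after commuting `M ⊂ K` to the left, this is
Iwasawa uniqueness with trivial `N`-part. -/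
theorem logA_eq (hss : LieAlgebra.IsSemisimple ℝ G.lieAlgebra) {x : D.AM} {X : D.a} {m : G.Pt}
    (hm : m ∈ D.M) (hx : (x : G.Pt) = G.exp X * m) : D.logA x = X := by
  obtain ⟨m', hm', h'⟩ := Classical.epsilon_spec
    (p := fun X : D.a => ∃ m ∈ D.M, (x : G.Pt) = G.exp X * m) ⟨X, m, hm, hx⟩
  rw [D.commute_of_mem_M hm' (D.exp_mem_A _)] at h'
  rw [D.commute_of_mem_M hm (D.exp_mem_A _)] at hx
  exact (D.exp_mul_inj hss hm'.2 hm.2 D.N.one_mem D.N.one_mem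
    (congrArg (· * 1) (h'.symm.trans hx))).1

theorem exists_eq_exp_logA_mul (x : D.AM) : ∃ m ∈ D.M, (x : G.Pt) = G.exp (D.logA x) * m :=
  Classical.epsilon_spec (p := fun X : D.a => ∃ m ∈ D.M, (x : G.Pt) = G.exp X * m)
    (D.exists_eq_exp_mul x.2)

theorem logA_mul (hss : LieAlgebra.IsSemisimple ℝ G.lieAlgebra) (x y : D.AM) :
    D.logA (x * y) = D.logA x + D.logA y := by
  obtain ⟨m, hm, hx⟩ := D.exists_eq_exp_logA_mul x
  obtain ⟨n, hn, hy⟩ := D.exists_eq_exp_logA_mul y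
  refine D.logA_eq hss (D.M.mul_mem hm hn) ?_
  rw [exp_a_add, Subgroup.coe_mul, hx, hy, mul_assoc (G.exp _), ← mul_assoc m,
    ← D.commute_of_mem_M hm (D.exp_mem_A (D.logA y))]
  group

theorem logA_expA (hss : LieAlgebra.IsSemisimple ℝ G.lieAlgebra) (X : D.a) :
    D.logA (D.expA X) = X :=
  D.logA_eq hss D.M.one_mem (mul_one _).symm

/-- The products `x u` already form a subgroup, because `AM` normalizes `N`. -/
theorem exists_eq_mul_of_mem_MAN {g : G.Pt} (hg : g ∈ D.MAN) :
    ∃ x ∈ D.AM, ∃ u ∈ D.N, g = x * u := by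
  have h : D.MAN ≤
      { carrier := {g | ∃ x ∈ D.AM, ∃ u ∈ D.N, g = x * u}
        one_mem' := ⟨1, D.AM.one_mem, 1, D.N.one_mem, by simp⟩
        mul_mem' := by
          rintro _ _ ⟨x, hx, u, hu, rfl⟩ ⟨y, hy, v, hv, rfl⟩
          refine ⟨x * y, D.AM.mul_mem hx hy, y⁻¹ * u * y * v,
            D.N.mul_mem (D.inv_conj_mem_N hy hu) hv, ?_⟩
          group
        inv_mem' := by
          rintro _ ⟨x, hx, u, hu, rfl⟩
          refine ⟨x⁻¹, D.AM.inv_mem hx, x * u⁻¹ * x⁻¹, D.conj_mem_N hx (D.N.inv_mem hu), ?_⟩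
          group } := by
    refine sup_le (sup_le ?_ ?_) ?_
    · exact fun m hm => ⟨m, Subgroup.mem_sup_right hm, 1, D.N.one_mem, (mul_one m).symm⟩
    · exact fun x hx => ⟨x, Subgroup.mem_sup_left hx, 1, D.N.one_mem, (mul_one x).symm⟩
    · exact fun u hu => ⟨1, D.AM.one_mem, u, hu, (one_mul u).symm⟩
  exact h hg

theorem mul_inj_of_mem_AM (hss : LieAlgebra.IsSemisimple ℝ G.lieAlgebra) {x y u v : G.Pt}
    (hx : x ∈ D.AM) (hy : y ∈ D.AM) (hu : u ∈ D.N) (hv : v ∈ D.N) (h : x * u = y * v) :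
    x = y ∧ u = v := by
  obtain ⟨X, m, hm, rfl⟩ := D.exists_eq_exp_mul hx
  obtain ⟨Y, n, hn, rfl⟩ := D.exists_eq_exp_mul hy
  have huv : u = v := by
    rw [D.commute_of_mem_M hm (D.exp_mem_A X), D.commute_of_mem_M hn (D.exp_mem_A Y)] at h
    exact (D.exp_mul_inj hss hm.2 hn.2 hu hv h).2
  subst huv
  exact ⟨mul_right_cancel h, rfl⟩

theorem mem_M_of_mem_K_of_mem_MAN (hss : LieAlgebra.IsSemisimple ℝ G.lieAlgebra) {k : G.Pt}
    (hk : k ∈ D.K) (h : k ∈ D.MAN) : k ∈ D.M := by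
  obtain ⟨x, hx, u, hu, rfl⟩ := D.exists_eq_mul_of_mem_MAN h
  obtain ⟨X, m, hm, rfl⟩ := D.exists_eq_exp_mul hx
  have h0 : G.exp ((0 : D.a) : G.lieAlgebra) = 1 := G.exp_zero
  -- Two Iwasawa decompositions of the same element of `K`, one of them with trivial `A`- and
  -- `N`-parts.
  obtain ⟨rfl, rfl⟩ := D.exp_mul_inj hss hm.2 hk hu D.N.one_mem
    (show m * G.exp X * u = G.exp X * m * u * G.exp (0 : D.a) * 1 by
      rw [h0, D.commute_of_mem_M hm (D.exp_mem_A X)]; group)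
  rw [h0]
  simpa using hm

theorem smul_η_eq_iff {g h : G.Pt} : g • D.η = h • D.η ↔ g⁻¹ * h ∈ D.MAN := by
  change (QuotientGroup.mk (g * 1) : D.F) = QuotientGroup.mk (h * 1) ↔ _
  rw [QuotientGroup.eq, mul_one, mul_one]

theorem kι_inv_conj_mem_A {x : G.Pt} (hx : x ∈ D.A) : D.kι⁻¹ * x * D.kι ∈ D.A := by
  obtain ⟨X, hX, rfl⟩ := hx
  refine ⟨_, D.AdHom_kι_inv_mem_a hX, ?_⟩
  rw [G.exp_AdHom, inv_inv]

theorem kι_conj_mem_AM {x : G.Pt} (hx : x ∈ D.AM) : D.kι * x * D.kι⁻¹ ∈ D.AM := by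
  have h : D.AM ≤ D.AM.comap (MulAut.conj D.kι).toMonoidHom := by
    refine sup_le (fun x hx => Subgroup.mem_sup_left (D.conj_kι_mem_A hx)) fun m hm =>
      Subgroup.mem_sup_right ⟨Subgroup.mem_centralizer_iff.2 fun x hx => ?_,
        D.K.mul_mem (D.K.mul_mem D.kι_mem hm.2) (D.K.inv_mem D.kι_mem)⟩
    have h2 := congrArg (fun y => D.kι * y * D.kι⁻¹)
      (D.commute_of_mem_M hm (D.kι_inv_conj_mem_A hx))
    simpa [mul_assoc] using h2
  exact h hx

/-- `k_ι` normalizes both `A` and `M`, so its conjugate of `AM` stays in the stabilizer of `η₀`. -/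
theorem smul_ηop_of_mem_AM {x : G.Pt} (hx : x ∈ D.AM) : x • D.ηop = D.ηop := by
  obtain ⟨X, m, hm, rfl⟩ := D.exists_eq_exp_mul hx
  have hA := D.kι_inv_conj_mem_A (D.exp_mem_A X)
  rw [mul_smul, D.smul_ηop_of_mem hm, ηop, ← mul_smul, smul_η_eq_iff]
  have : (G.exp X * D.kι)⁻¹ * D.kι = (D.kι⁻¹ * G.exp X * D.kι)⁻¹ := by group
  rw [this]
  exact D.AM_le_MAN (Subgroup.mem_sup_left (D.A.inv_mem hA))

/-- `N` acts freely on the orbit of the opposite base point. -/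
theorem eq_one_of_smul_ηop {u : G.Pt} (hu : u ∈ D.N) (h : u • D.ηop = D.ηop) : u = 1 := by
  rw [ηop, ← mul_smul, eq_comm, smul_η_eq_iff] at h
  obtain ⟨x, hx, v, hv, e⟩ := D.exists_eq_mul_of_mem_MAN h
  refine D.eq_one_of_eq_mul_conj_kι hu (D.kι_conj_mem_AM hx) hv ?_
  have h1 : u = D.kι * (D.kι⁻¹ * (u * D.kι)) * D.kι⁻¹ := by group
  rw [h1, e]
  group

/-! ### The Iwasawa cocycle -/

/-- One representative `k` determines the cocycle: any other differs by an element of `M`, which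
commutes with `A` and normalizes `N`. Iwasawa uniqueness then identifies the chosen value. -/
theorem σ_eq (hss : LieAlgebra.IsSemisimple ℝ G.lieAlgebra) {g k k' u : G.Pt} {x : D.AM}
    (hk : k ∈ D.K) (hk' : k' ∈ D.K) (hu : u ∈ D.N) (h : g * k = k' * x * u) :
    D.σ g (k • D.η) = D.logA x := by
  have hI : D.IsIwasawa g (k • D.η) (D.logA x) := by
    intro l hl hlη
    have hm : k⁻¹ * l ∈ D.M := D.mem_M_of_mem_K_of_mem_MAN hss
      (D.K.mul_mem (D.K.inv_mem hk) hl) (D.smul_η_eq_iff.1 hlη.symm)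
    obtain ⟨n, hn, hx⟩ := D.exists_eq_exp_logA_mul x
    refine ⟨k' * (n * (k⁻¹ * l)), D.K.mul_mem hk' (D.K.mul_mem hn.2 hm.2),
      (k⁻¹ * l)⁻¹ * u * (k⁻¹ * l), D.inv_conj_mem_N (Subgroup.mem_sup_right hm) hu, ?_⟩
    have e : g * l = g * k * (k⁻¹ * l) := by group
    have hc := D.commute_of_mem_M (D.M.mul_mem hn hm) (D.exp_mem_A (D.logA x))
    rw [mul_assoc k', ← hc, e, h, hx]
    group
  obtain ⟨k₁, hk₁, u₁, hu₁, e₁⟩ := Classical.epsilon_spec ⟨_, hI⟩ k hk rfl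
  obtain ⟨k₂, hk₂, u₂, hu₂, e₂⟩ := hI k hk rfl
  exact (D.exp_mul_inj hss hk₁ hk₂ hu₁ hu₂ (e₁.symm.trans e₂)).1

/-! ### Coordinates and cocycles of cross-sections -/

namespace CrossSection

variable {D} (s : D.CrossSection)

theorem toFun_smul_η {ξ : D.F} (hξ : ξ ∈ s.dom) : s.toFun ξ • D.η = ξ := by
  conv_rhs => rw [← s.mk_toFun ξ hξ]
  change (QuotientGroup.mk (s.toFun ξ * 1) : D.F) = _
  rw [mul_one]

variable {s}

theorem eq_smul_η {ξ : D.F} (hξ : ξ ∈ s.dom) {u x : G.Pt} (hu : u ∈ D.N) (hx : x ∈ D.AM) :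
    (s.toFun ξ * u * x) • D.η = ξ := by
  rw [mul_smul, mul_smul, D.smul_η_of_mem (D.AM_le_MAN hx), D.smul_η_of_mem (D.N_le_MAN hu),
    s.toFun_smul_η hξ]

theorem lastCoord_eq (hss : LieAlgebra.IsSemisimple ℝ G.lieAlgebra) {g : G.Pt} {ξ : D.F}
    (hξ : ξ ∈ s.dom) {u : G.Pt} (hu : u ∈ D.N) {x : D.AM} (hg : g = s.toFun ξ * u * x) :
    s.lastCoord g = x := by
  obtain ⟨ξ', hξ', u', hu', e⟩ := Classical.epsilon_spec
    (p := fun x : D.AM => ∃ ξ ∈ s.dom, ∃ u ∈ D.N, g = s.toFun ξ * u * x) ⟨x, ξ, hξ, u, hu, hg⟩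
  change g = s.toFun ξ' * u' * s.lastCoord g at e
  have hξξ : ξ' = ξ := by
    rw [← eq_smul_η hξ' hu' (s.lastCoord g).2, ← e, hg, eq_smul_η hξ hu x.2]
  subst hξξ
  have h1 : u' * s.lastCoord g = u * x := by
    refine mul_left_cancel (a := s.toFun ξ') ?_
    rw [← mul_assoc, ← mul_assoc, ← e, hg]
  -- Inverting puts the `AM`-factor on the left, as required by `mul_inj_of_mem_AM`.
  have h2 := congrArg (·⁻¹) h1
  simp only [_root_.mul_inv_rev] at h2
  have h3 := (D.mul_inj_of_mem_AM hss (D.AM.inv_mem (s.lastCoord g).2) (D.AM.inv_mem x.2)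
    (D.N.inv_mem hu') (D.N.inv_mem hu) h2).1
  exact Subtype.ext (inv_injective h3)

/-- An element `g` of the cell is `s(g η₀) u x` with `u ∈ N` and `x` its last coordinate. -/
theorem exists_eq_mul_lastCoord (hss : LieAlgebra.IsSemisimple ℝ G.lieAlgebra) (g : s.cell) :
    ∃ u ∈ D.N, (g : G.Pt) = s.toFun ((g : G.Pt) • D.η) * u * s.lastCoord g := by
  obtain ⟨g, ξ, hξ, u, hu, x, hx, rfl⟩ := g
  refine ⟨u, hu, ?_⟩
  rw [lastCoord_eq hss hξ hu (x := ⟨x, hx⟩) rfl]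
  simp only [eq_smul_η hξ hu hx]

theorem coord_bijective (hss : LieAlgebra.IsSemisimple ℝ G.lieAlgebra) :
    Function.Bijective s.coord := by
  constructor
  · intro g h hgh
    obtain ⟨u, hu, eg⟩ := exists_eq_mul_lastCoord hss g
    obtain ⟨v, hv, eh⟩ := exists_eq_mul_lastCoord hss h
    have hpair := congrArg (fun c => c.1.1) hgh
    have h1 : (g : G.Pt) • D.η = (h : G.Pt) • D.η := congrArg Prod.fst hpair
    have h2 : (g : G.Pt) • D.ηop = (h : G.Pt) • D.ηop := congrArg Prod.snd hpair
    have h3 : s.lastCoord g = s.lastCoord h := congrArg Prod.snd hgh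
    rw [← h1, ← h3] at eh
    -- Since `AM` fixes `η̌₀`, the second boundary point depends only on `s(ξ)` and the `N`-factor,
    -- which is recovered because `N` acts freely there.
    rw [eg, eh, mul_smul, mul_smul _ _ D.ηop, D.smul_ηop_of_mem_AM (s.lastCoord g).2, mul_smul,
      mul_smul, smul_left_cancel_iff] at h2
    have h4 : v⁻¹ * u = 1 := by
      refine D.eq_one_of_smul_ηop (D.N.mul_mem (D.N.inv_mem hv) hu) ?_
      rw [mul_smul, h2, inv_smul_smul]
    have h5 : v = u := inv_mul_eq_one.1 h4
    exact Subtype.ext (by rw [eg, eh, h5])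
  · rintro ⟨⟨⟨ξ, ξ'⟩, hξ, g, hg⟩, x⟩
    obtain ⟨rfl, rfl⟩ := Prod.mk.inj hg
    -- Any `g` realizing the pair factors as `s(ξ) u' y`; replacing `y` by the prescribed `x` leaves
    -- both boundary points unchanged.
    have hb : (s.toFun (g • D.η))⁻¹ * g ∈ D.MAN :=
      D.smul_η_eq_iff.1 (s.toFun_smul_η hξ)
    obtain ⟨y, hy, u, hu, e⟩ := D.exists_eq_mul_of_mem_MAN hb
    have hu' := D.conj_mem_N hy hu
    have hge : g = s.toFun (g • D.η) * (y * u * y⁻¹) * y := by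
      rw [mul_assoc, inv_mul_cancel_right, ← e, mul_inv_cancel_left]
    refine ⟨⟨s.toFun (g • D.η) * (y * u * y⁻¹) * x, _, hξ, _, hu', x, x.2, rfl⟩, ?_⟩
    refine Prod.ext (Subtype.ext (Prod.ext (eq_smul_η hξ hu' x.2) ?_))
      (lastCoord_eq hss hξ hu' rfl)
    change (s.toFun (g • D.η) * (y * u * y⁻¹) * x) • D.ηop = g • D.ηop
    conv_rhs => rw [hge]
    rw [mul_smul, D.smul_ηop_of_mem_AM x.2, mul_smul _ y, D.smul_ηop_of_mem_AM hy]

/-- From `h = s(ξ) u x = s(ξ) x (x⁻¹ u x)` with `s(ξ) ∈ K`, the Iwasawa part of `h` at `η₀` is read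
off with `k = 1`. -/
theorem hopf_mk_eq (hss : LieAlgebra.IsSemisimple ℝ G.lieAlgebra) (hs : s.CompactValued)
    (h : s.cell) : D.hopf (QuotientGroup.mk (h : G.Pt)) = s.toHopf (s.coord h) := by
  refine Prod.ext rfl ?_
  change D.σ h D.η = D.logA (s.lastCoord h)
  obtain ⟨u, hu, e⟩ := exists_eq_mul_lastCoord hss h
  have := D.σ_eq hss (g := h) (k := 1) D.K.one_mem (hs _ (s.smul_η_mem_dom h.2))
    (D.inv_conj_mem_N (s.lastCoord h).2 hu) (x := s.lastCoord h) (by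
      rw [mul_one]
      nth_rewrite 1 [e]
      group)
  rwa [one_smul] at this

/-- Both `g s(ξ)` and `s'(gξ)` send `η₀` to `gξ`, so they differ by an element of `MAN = AM·N`. -/
theorem exists_eq_β_mul {s' : D.CrossSection} {g : G.Pt} {ξ : D.F} (hξ : ξ ∈ s.dom)
    (hgξ : g • ξ ∈ s'.dom) :
    ∃ u ∈ D.N, g * s.toFun ξ = s'.toFun (g • ξ) * s'.β s g ξ * u := by
  refine Classical.epsilon_spec
    (p := fun b : D.AM => ∃ u ∈ D.N, g * s.toFun ξ = s'.toFun (g • ξ) * b * u) ?_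
  have hb : (s'.toFun (g • ξ))⁻¹ * (g * s.toFun ξ) ∈ D.MAN := by
    rw [← D.smul_η_eq_iff, s'.toFun_smul_η hgξ, mul_smul, s.toFun_smul_η hξ]
  obtain ⟨y, hy, u, hu, e⟩ := D.exists_eq_mul_of_mem_MAN hb
  exact ⟨⟨y, hy⟩, u, hu, by rw [mul_assoc, ← e, mul_inv_cancel_left]⟩

/-- With both sections valued in `K`, the relation defining `β` is itself an Iwasawa decomposition
of `g s(ξ)`, up to the `M`-part of `β`. -/
theorem logA_β (hss : LieAlgebra.IsSemisimple ℝ G.lieAlgebra) (hs : s.CompactValued)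
    {s' : D.CrossSection} (hs' : s'.CompactValued) {g : G.Pt} {ξ : D.F} (hξ : ξ ∈ s.dom)
    (hgξ : g • ξ ∈ s'.dom) : D.logA (s'.β s g ξ) = D.σ g ξ := by
  obtain ⟨u, hu, e⟩ := exists_eq_β_mul hξ hgξ
  have := D.σ_eq hss (hs ξ hξ) (hs' _ hgξ) hu e
  rw [s.toFun_smul_η hξ] at this
  exact this.symm

end CrossSection

end ClosedSubgroup.CartanData

/-! ### The proposition -/

open ClosedSubgroup CartanData CrossSection in
theorem proposition3p10 {d : ℕ} (G : ClosedSubgroup (GL (Fin d) ℝ))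
    (hconn : IsConnected (G.toSubgroup : Set (GL (Fin d) ℝ)))
    (hss : LieAlgebra.IsSemisimple ℝ G.lieAlgebra) (hnc : G.NoCompactFactor)
    (D : G.CartanData) (s : D.CrossSection) (hs : s.CompactValued) :
    -- every `(ξ, ξ̌ ; x)` is the coordinate of exactly one element of `s(𝓕_s)NAM`
    Function.Bijective s.coord ∧
    -- the diagram with the Hopf coordinates commutes
    (∀ h : s.cell, D.hopf (QuotientGroup.mk (h : G.Pt)) = s.toHopf (s.coord h)) ∧
    -- the left action of `G`
    (∀ s' : D.CrossSection, s'.CompactValued → ∀ (g : G.Pt) (ξ : D.F), ξ ∈ s.dom → g • ξ ∈ s'.dom →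
      D.logA (s'.β s g ξ) = D.σ g ξ ∧
      ∀ (ξ' : D.F) (hq : (ξ, ξ') ∈ s.F2) (x : D.AM) (h : s.cell),
        s.coord h = (⟨(ξ, ξ'), hq⟩, x) →
        ∃ (hc : g * (h : G.Pt) ∈ s'.cell) (hq₁ : (g • ξ, g • ξ') ∈ s'.F2),
          s'.coord ⟨g * h, hc⟩ = (⟨(g • ξ, g • ξ'), hq₁⟩, s'.β s g ξ * x) ∧
          D.hopf (QuotientGroup.mk (h : G.Pt)) = (⟨(ξ, ξ'), hq.2⟩, D.logA x) ∧
          s'.toHopf (s'.coord ⟨g * h, hc⟩) = D.hopf (g • (QuotientGroup.mk (h : G.Pt))) ∧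
          D.hopf (g • (QuotientGroup.mk (h : G.Pt))) =
            (⟨(g • ξ, g • ξ'), hq₁.2⟩, D.σ g ξ + D.logA x)) ∧
    -- the right action of `A`
    (∀ (ξ ξ' : D.F) (hq : (ξ, ξ') ∈ s.F2) (x : D.AM) (h : s.cell),
      s.coord h = (⟨(ξ, ξ'), hq⟩, x) → ∀ (θ : D.a) (t : ℝ),
        ∃ hc : D.flow θ t h ∈ s.cell,
          s.coord ⟨D.flow θ t h, hc⟩ = (⟨(ξ, ξ'), hq⟩, x * D.expA (t • θ)) ∧
          s.toHopf (s.coord ⟨D.flow θ t h, hc⟩) =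
            D.hopf (D.weylFlow θ t (QuotientGroup.mk (h : G.Pt))) ∧
          D.hopf (D.weylFlow θ t (QuotientGroup.mk (h : G.Pt))) =
            (⟨(ξ, ξ'), hq.2⟩, D.logA x + t • θ)) := by
  refine ⟨coord_bijective hss, hopf_mk_eq hss hs, ?_, ?_⟩
  · intro s' hs' g ξ hξ hgξ
    refine ⟨logA_β hss hs hs' hξ hgξ, fun ξ' hq x h hh => ?_⟩
    have hξh : (h : G.Pt) • D.η = ξ := congrArg (fun c => c.1.1.1) hh
    have hξ'h : (h : G.Pt) • D.ηop = ξ' := congrArg (fun c => c.1.1.2) hh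
    have hx : s.lastCoord h = x := congrArg Prod.snd hh
    obtain ⟨u, hu, e⟩ := exists_eq_mul_lastCoord hss h
    obtain ⟨v, hv, eβ⟩ := exists_eq_β_mul (s' := s') hξ hgξ
    rw [hξh, hx] at e
    have hβ := (s'.β s g ξ).2
    -- Conjugation by `β` carries the accumulated `N`-factor `v u` to its left, which leaves `β x`
    -- as last coordinate.
    have e' : g * (h : G.Pt) = s'.toFun (g • ξ) *
        (s'.β s g ξ * (v * u) * (s'.β s g ξ : G.Pt)⁻¹) * (s'.β s g ξ * x : D.AM) := by
      rw [e, mul_assoc (s.toFun ξ), ← mul_assoc, eβ, Subgroup.coe_mul]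
      group
    have hw := D.conj_mem_N hβ (D.N.mul_mem hv hu)
    have hc : g * (h : G.Pt) ∈ s'.cell :=
      ⟨_, hgξ, _, hw, _, (s'.β s g ξ * x).2, e'⟩
    have hq₁ : (g • ξ, g • ξ') ∈ s'.F2 := by
      refine ⟨hgξ, g * h, ?_⟩
      rw [mul_smul, mul_smul, hξh, hξ'h]
    have hcoord : s'.coord ⟨g * h, hc⟩ = (⟨(g • ξ, g • ξ'), hq₁⟩, s'.β s g ξ * x) := by
      refine Prod.ext (Subtype.ext (Prod.ext ?_ ?_)) (lastCoord_eq hss hgξ hw e')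
      · exact (mul_smul g (h : G.Pt) D.η).trans (by rw [hξh])
      · exact (mul_smul g (h : G.Pt) D.ηop).trans (by rw [hξ'h])
    have hhopf := hopf_mk_eq hss hs' ⟨g * h, hc⟩
    refine ⟨hc, hq₁, hcoord, ?_, hhopf.symm, ?_⟩
    · rw [hopf_mk_eq hss hs, hh]; rfl
    · refine hhopf.trans ?_
      rw [hcoord, ← logA_β hss hs hs' hξ hgξ, ← D.logA_mul hss]; rfl
  · intro ξ ξ' hq x h hh θ t
    have hξh : (h : G.Pt) • D.η = ξ := congrArg (fun c => c.1.1.1) hh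
    have hξ'h : (h : G.Pt) • D.ηop = ξ' := congrArg (fun c => c.1.1.2) hh
    have hx : s.lastCoord h = x := congrArg Prod.snd hh
    obtain ⟨u, hu, e⟩ := exists_eq_mul_lastCoord hss h
    rw [hξh, hx] at e
    have e' : D.flow θ t h = s.toFun ξ * u * (x * D.expA (t • θ) : D.AM) := by
      rw [flow, e, mul_assoc, Subgroup.coe_mul]
    have hc : D.flow θ t h ∈ s.cell := ⟨_, hq.1, _, hu, _, (x * D.expA (t • θ)).2, e'⟩
    have hcoord : s.coord ⟨D.flow θ t h, hc⟩ = (⟨(ξ, ξ'), hq⟩, x * D.expA (t • θ)) := by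
      have hA := (D.expA (t • θ)).2
      refine Prod.ext (Subtype.ext (Prod.ext ?_ ?_)) (lastCoord_eq hss hq.1 hu e')
      · exact (mul_smul (h : G.Pt) (D.expA (t • θ) : G.Pt) D.η).trans
          (by rw [D.smul_η_of_mem (D.AM_le_MAN hA), hξh])
      · exact (mul_smul (h : G.Pt) (D.expA (t • θ) : G.Pt) D.ηop).trans
          (by rw [D.smul_ηop_of_mem_AM hA, hξ'h])
    have hhopf := hopf_mk_eq hss hs ⟨D.flow θ t h, hc⟩
    refine ⟨hc, hcoord, hhopf.symm, hhopf.trans ?_⟩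
    -- The displacement `tθ` is written as a `logA` so that additivity applies; the last rewrite
    -- removes the nested copy this creates inside `expA`.
    rw [hcoord, ← D.logA_expA hss (t • θ), ← D.logA_mul hss, D.logA_expA hss]; rfl
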